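/- Let $d$ be the number of edges, $\ell_1,\dots,\ell_d>0$ the edge lengths, and $q_j\in W^{1,1}((0,\ell_j))$ real potentials. Let $U$ be a unitary $2d\times 2d$ matrix with $-1\notin\sigma(U)$, and let $H=-i(U+I)^{-1}(U-I)$. For $k\in\mathbb{C}$ let $c_j(\cdot,k)$ and $s_j(\cdot,k)$ be the solutions on $[0,\ell_j]$ of $$c_j(x,k)=\cos(kx)+\int_0^x\frac{\sin(k(x-t))}{k}\,q_j(t)\,c_j(t,k)\,dt,\qquad s_j(x,k)=\frac{\sin(kx)}{k}+\int_0^x\frac{\sin(k(x-t))}{k}\,q_j(t)\,s_j(t,k)\,dt,$$ where $\sin(kx)/k$ is read as $x$ at $k=0$. Let $M_1(k)$ and $M_2(k)$ be the block diagonal $2d\times 2d$ matrices with $j$-th diagonal blocks $$\begin{pmatrix}1&0\\ c_j(\ell_j,k)&s_j(\ell_j,k)\end{pmatrix}\qquad\text{and}\qquad\begin{pmatrix}0&1\\ -c_j'(\ell_j,k)&-s_j'(\ell_j,k)\end{pmatrix}$$ respectively (prime denotes the derivative in $x$), and define the secular function $\varphi(k)=\det[H M_1(k)+M_2(k)]$.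 For $N>0$ let $\Gamma_N$ be the square contour with vertices $\pm N\pm iN$. Then $\varphi$ is an entire function, and for every $\varepsilon>0$ there exists $K>0$ such that for all real $N>K$ with $$N\notin\bigcup_{i=1}^d\bigcup_{n\in\mathbb{N}_0}\left(\frac{n\pi}{\ell_i}-\frac{\varepsilon}{\ell_i},\ \frac{n\pi}{\ell_i}+\frac{\varepsilon}{\ell_i}\right)$$ the functions $\varphi(k)$ and $\prod_{i=1}^d(-k\sin(k\ell_i))$ have the same finite number of zeros, counted with multiplicity, inside $\Gamma_N$. -/

import Mathlib

open MeasureTheory Set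
open scoped ContDiff

noncomputable section

namespace QGraph

/-- `q ∈ W^{1,1}((0, ℓ))`: `q` is integrable on `(0, ℓ)` and has an integrable weak derivative. -/
def MemW11 (ℓ : ℝ) (q : ℝ → ℝ) : Prop :=
  IntegrableOn q (Ioo 0 ℓ) ∧
    ∃ g : ℝ → ℝ, IntegrableOn g (Ioo 0 ℓ) ∧
      ∀ η : ℝ → ℝ, ContDiff ℝ ∞ η → HasCompactSupport η → tsupport η ⊆ Ioo 0 ℓ →
        ∫ x in Ioo 0 ℓ, q x * deriv η x = - ∫ x in Ioo 0 ℓ, g x * η x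

/-- `sin (k x) / k`, with its limiting value `x` at `k = 0`. -/
def sinKernel (k : ℂ) (x : ℝ) : ℂ :=
  if k = 0 then (x : ℂ) else Complex.sin (k * x) / k

/-- The integral operator `f ↦ ∫₀ˣ (sin (k (x - t)) / k) q(t) f(t) dt`. -/
def volterraOp (q : ℝ → ℝ) (k : ℂ) (f : ℝ → ℂ) (x : ℝ) : ℂ :=
  ∫ t in (0 : ℝ)..x, sinKernel k (x - t) * (q t : ℂ) * f t

/-- The solution `y` of the Volterra equation `y = f + volterraOp q k y`, as the series obtained by
repeated substitution. `volterraSol_eq` and `volterraSol_unique` below show that it is the unique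
continuous solution. -/
def volterraSol (q : ℝ → ℝ) (k : ℂ) (f : ℝ → ℂ) (x : ℝ) : ℂ :=
  ∑' n : ℕ, ((volterraOp q k)^[n] f) x

lemma sinKernel_sub (k : ℂ) (x t : ℝ) :
    sinKernel k (x - t) =
      sinKernel k x * Complex.cos (k * t) - Complex.cos (k * x) * sinKernel k t := by
  unfold sinKernel
  split_ifs with h
  · simp [h]
  · push_cast
    rw [mul_sub, Complex.sin_sub]
    field_simp

lemma continuous_sinKernel (k : ℂ) : Continuous (sinKernel k) := by
  unfold sinKernel
  split_ifs with h
  · fun_prop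
  · fun_prop

lemma MemW11.intervalIntegrable {ℓ : ℝ} {q : ℝ → ℝ} (hℓ : 0 ≤ ℓ) (hq : MemW11 ℓ q) :
    IntervalIntegrable q volume 0 ℓ := by
  rw [intervalIntegrable_iff_integrableOn_Ioo_of_le hℓ]
  exact hq.1

section Volterra

variable {ℓ : ℝ} {q : ℝ → ℝ} {k : ℂ} {f : ℝ → ℂ}

lemma intervalIntegrable_mul (hq : IntervalIntegrable q volume 0 ℓ)
    {g : ℝ → ℂ} (hℓ : 0 ≤ ℓ) (hg : ContinuousOn g (Icc 0 ℓ)) :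
    IntervalIntegrable (fun t => (q t : ℂ) * g t) volume 0 ℓ := by
  have h : IntervalIntegrable (fun t => (q t : ℂ)) volume 0 ℓ :=
    ⟨hq.1.ofReal, hq.2.ofReal⟩
  exact h.mul_continuousOn (by rwa [uIcc_of_le hℓ])

lemma intervalIntegrable_sub {g : ℝ → ℂ} (hg : IntervalIntegrable g volume 0 ℓ)
    {x : ℝ} (hx : x ∈ Icc 0 ℓ) : IntervalIntegrable g volume 0 x := by
  refine hg.mono_set ?_
  rw [uIcc_of_le hx.1, uIcc_of_le (hx.1.trans hx.2)]
  exact Icc_subset_Icc_right hx.2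

lemma volterraOp_expand (hq : IntervalIntegrable q volume 0 ℓ) (hf : ContinuousOn f (Icc 0 ℓ))
    {x : ℝ} (hx : x ∈ Icc 0 ℓ) :
    volterraOp q k f x =
      sinKernel k x * (∫ t in (0 : ℝ)..x, (q t : ℂ) * (Complex.cos (k * t) * f t)) -
      Complex.cos (k * x) * (∫ t in (0 : ℝ)..x, (q t : ℂ) * (sinKernel k t * f t)) := by
  have hℓ : 0 ≤ ℓ := hx.1.trans hx.2
  have hs := continuous_sinKernel k
  have h1 : IntervalIntegrable (fun t => (q t : ℂ) * (Complex.cos (k * t) * f t)) volume 0 x :=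
    intervalIntegrable_sub (intervalIntegrable_mul hq hℓ
      ((by fun_prop : Continuous fun t : ℝ => Complex.cos (k * t)).continuousOn.mul hf)) hx
  have h2 : IntervalIntegrable (fun t => (q t : ℂ) * (sinKernel k t * f t)) volume 0 x :=
    intervalIntegrable_sub (intervalIntegrable_mul hq hℓ (hs.continuousOn.mul hf)) hx
  rw [← intervalIntegral.integral_const_mul, ← intervalIntegral.integral_const_mul,
    ← intervalIntegral.integral_sub (h1.const_mul _) (h2.const_mul _)]
  unfold volterraOp
  congr 1
  ext t
  rw [sinKernel_sub]
  ring

lemma continuousOn_volterraOp (hq : IntervalIntegrable q volume 0 ℓ)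
    (hf : ContinuousOn f (Icc 0 ℓ)) : ContinuousOn (volterraOp q k f) (Icc 0 ℓ) := by
  rcases le_or_gt 0 ℓ with hℓ | hℓ
  swap
  · simp [Icc_eq_empty (not_le.2 hℓ)]
  have hs := continuous_sinKernel k
  have key : ∀ g : ℝ → ℂ, ContinuousOn g (Icc 0 ℓ) →
      ContinuousOn (fun x => ∫ t in (0 : ℝ)..x, (q t : ℂ) * g t) (Icc 0 ℓ) := by
    intro g hg
    have h := intervalIntegral.continuousOn_primitive_interval'
      (intervalIntegrable_mul hq hℓ hg) left_mem_uIcc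
    rwa [uIcc_of_le hℓ] at h
  have hc : Continuous fun t : ℝ => Complex.cos (k * t) := by fun_prop
  refine ContinuousOn.congr ?_ (fun x hx => volterraOp_expand hq hf hx)
  exact (hs.continuousOn.mul (key _ (hc.continuousOn.mul hf))).sub
    (hc.continuousOn.mul (key _ (hs.continuousOn.mul hf)))

lemma continuousOn_iterate (hq : IntervalIntegrable q volume 0 ℓ)
    (hf : ContinuousOn f (Icc 0 ℓ)) (n : ℕ) :
    ContinuousOn ((volterraOp q k)^[n] f) (Icc 0 ℓ) := by
  induction n with
  | zero => simpa using hf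
  | succ n ih =>
    rw [Function.iterate_succ_apply']
    exact continuousOn_volterraOp hq ih

lemma integral_abs_mul_pow (hq : IntervalIntegrable q volume 0 ℓ) {x : ℝ} (hx : x ∈ Icc 0 ℓ)
    (n : ℕ) :
    ∫ t in (0 : ℝ)..x, |q t| * (∫ s in (0 : ℝ)..t, |q s|) ^ n =
      (∫ s in (0 : ℝ)..x, |q s|) ^ (n + 1) / (n + 1) := by
  have hqx : IntervalIntegrable (fun t => |q t|) volume 0 x := by
    refine (hq.mono_set ?_).abs
    rw [uIcc_of_le hx.1, uIcc_of_le (hx.1.trans hx.2)]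
    exact Icc_subset_Icc_right hx.2
  set Q : ℝ → ℝ := fun t => ∫ s in (0 : ℝ)..t, |q s| with hQ
  have hac : AbsolutelyContinuousOnInterval Q 0 x :=
    hqx.absolutelyContinuousOnInterval_intervalIntegral left_mem_uIcc
  have hpow : ∀ m : ℕ, AbsolutelyContinuousOnInterval (fun t => Q t ^ (m + 1)) 0 x := by
    intro m
    induction m with
    | zero => simpa using hac
    | succ m ih =>
      have := ih.mul hac
      have e : (fun t => Q t ^ (m + 1 + 1)) = (fun t => Q t ^ (m + 1)) * Q := by
        ext t
        simp [pow_succ]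
      rwa [e]
  have h0 := (hpow n).integral_deriv_eq_sub
  have hae : ∀ᵐ t, t ∈ uIoc 0 x → HasDerivAt Q (|q t|) t := by
    have h := hqx.ae_hasDerivAt_integral
    filter_upwards [h] with t ht htm
    exact ht (uIoc_subset_uIcc htm) 0 left_mem_uIcc
  have h1 : ∫ t in (0 : ℝ)..x, deriv (fun t => Q t ^ (n + 1)) t =
      ∫ t in (0 : ℝ)..x, ((n : ℝ) + 1) * (|q t| * Q t ^ n) := by
    refine intervalIntegral.integral_congr_ae ?_
    filter_upwards [hae] with t ht htm
    have := ((ht htm).pow (n + 1)).deriv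
    have e : (Q ^ (n + 1)) = fun t => Q t ^ (n + 1) := by ext; simp
    rw [e] at this
    rw [this]
    push_cast
    ring_nf
  rw [h1, intervalIntegral.integral_const_mul] at h0
  have hQ0 : Q 0 = 0 := by simp [hQ]
  rw [hQ0] at h0
  have hn : ((n : ℝ) + 1) ≠ 0 := by positivity
  rw [eq_div_iff hn, mul_comm, h0]
  simp [hQ]

lemma iterate_bound (hq : IntervalIntegrable q volume 0 ℓ)
    {M F : ℝ} (hM : ∀ x ∈ Icc 0 ℓ, ‖sinKernel k x‖ ≤ M) (hF : ∀ x ∈ Icc 0 ℓ, ‖f x‖ ≤ F)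
    (n : ℕ) : ∀ x ∈ Icc 0 ℓ, ‖((volterraOp q k)^[n] f) x‖ ≤
      F * (M * ∫ t in (0 : ℝ)..x, |q t|) ^ n / n.factorial := by
  induction n with
  | zero => simpa using hF
  | succ n ih =>
    intro x hx
    have hℓ : 0 ≤ ℓ := hx.1.trans hx.2
    have hM0 : 0 ≤ M := (norm_nonneg _).trans (hM x hx)
    rw [Function.iterate_succ_apply']
    have hsub : uIcc 0 x ⊆ uIcc 0 ℓ := by
      rw [uIcc_of_le hx.1, uIcc_of_le hℓ]
      exact Icc_subset_Icc_right hx.2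
    have hqx : IntervalIntegrable (fun t => |q t|) volume 0 x := (hq.mono_set hsub).abs
    have hQc : ContinuousOn (fun t => ∫ s in (0 : ℝ)..t, |q s|) (uIcc 0 x) :=
      intervalIntegral.continuousOn_primitive_interval' hqx left_mem_uIcc
    have hint : IntervalIntegrable
        (fun t => (F * M ^ (n + 1) / n.factorial) *
          (|q t| * (∫ s in (0 : ℝ)..t, |q s|) ^ n)) volume 0 x :=
      (hqx.mul_continuousOn (hQc.pow n)).const_mul _
    have hle := intervalIntegral.norm_integral_le_of_norm_le (μ := volume) hx.1
      (f := fun t => sinKernel k (x - t) * (q t : ℂ) * ((volterraOp q k)^[n] f) t)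
      (Filter.Eventually.of_forall (fun t ht => ?_)) hint
    · refine hle.trans (le_of_eq ?_)
      rw [intervalIntegral.integral_const_mul, integral_abs_mul_pow hq hx, Nat.factorial_succ]
      push_cast
      have : (n.factorial : ℝ) ≠ 0 := by positivity
      field_simp
      ring
    · have ht' : t ∈ Icc 0 ℓ := ⟨ht.1.le, ht.2.trans hx.2⟩
      have h1 : ‖sinKernel k (x - t)‖ ≤ M :=
        hM _ ⟨by linarith [ht.2], by linarith [ht.1, hx.2]⟩
      rw [norm_mul, norm_mul, Complex.norm_real, Real.norm_eq_abs]
      calc _ ≤ M * |q t| * (F * (M * ∫ s in (0 : ℝ)..t, |q s|) ^ n / n.factorial) := by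
            gcongr
            exact ih t ht'
        _ = _ := by ring

lemma exists_bounds (k : ℂ) (hf : ContinuousOn f (Icc 0 ℓ)) :
    ∃ M F : ℝ, 0 ≤ M ∧ 0 ≤ F ∧ (∀ x ∈ Icc 0 ℓ, ‖sinKernel k x‖ ≤ M) ∧
      (∀ x ∈ Icc 0 ℓ, ‖f x‖ ≤ F) := by
  obtain ⟨M, hM⟩ := isCompact_Icc.exists_bound_of_continuousOn
    (continuous_sinKernel k).continuousOn (s := Icc 0 ℓ)
  obtain ⟨F, hF⟩ := isCompact_Icc.exists_bound_of_continuousOn hf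
  exact ⟨max M 0, max F 0, le_max_right _ _, le_max_right _ _,
    fun x hx => (hM x hx).trans (le_max_left _ _), fun x hx => (hF x hx).trans (le_max_left _ _)⟩

lemma exists_iterate_bound (k : ℂ) (hq : IntervalIntegrable q volume 0 ℓ)
    (hf : ContinuousOn f (Icc 0 ℓ)) :
    ∃ u : ℕ → ℝ, Summable u ∧ ∀ n, ∀ x ∈ Icc 0 ℓ, ‖((volterraOp q k)^[n] f) x‖ ≤ u n := by
  obtain ⟨M, F, hM0, hF0, hM, hF⟩ := exists_bounds k hf
  refine ⟨fun n => F * ((M * ∫ t in (0 : ℝ)..ℓ, |q t|) ^ n / n.factorial),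
    (Real.summable_pow_div_factorial _).mul_left _, fun n x hx => ?_⟩
  refine (iterate_bound hq hM hF n x hx).trans ?_
  rw [mul_div_assoc]
  have h0 : 0 ≤ ∫ t in (0 : ℝ)..x, |q t| :=
    intervalIntegral.integral_nonneg hx.1 (fun t _ => abs_nonneg _)
  have h1 : ∫ t in (0 : ℝ)..x, |q t| ≤ ∫ t in (0 : ℝ)..ℓ, |q t| :=
    intervalIntegral.integral_mono_interval le_rfl hx.1 hx.2
      (Filter.Eventually.of_forall fun t => abs_nonneg _) hq.abs
  dsimp only
  gcongr

lemma continuousOn_volterraSol (hq : IntervalIntegrable q volume 0 ℓ)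
    (hf : ContinuousOn f (Icc 0 ℓ)) : ContinuousOn (volterraSol q k f) (Icc 0 ℓ) := by
  obtain ⟨u, hu, hb⟩ := exists_iterate_bound k hq hf
  exact continuousOn_tsum (fun n => continuousOn_iterate hq hf n) hu hb

/-- The series solves the Volterra equation. -/
theorem volterraSol_eq (hq : IntervalIntegrable q volume 0 ℓ) (hf : ContinuousOn f (Icc 0 ℓ))
    {x : ℝ} (hx : x ∈ Icc 0 ℓ) :
    volterraSol q k f x = f x +
      ∫ t in (0 : ℝ)..x, sinKernel k (x - t) * (q t : ℂ) * volterraSol q k f t := by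
  have hℓ : 0 ≤ ℓ := hx.1.trans hx.2
  obtain ⟨u, hu, hb⟩ := exists_iterate_bound k hq hf
  obtain ⟨M, F, hM0, hF0, hM, hF⟩ := exists_bounds k hf
  have hsum : ∀ t ∈ Icc 0 ℓ, Summable fun n => ((volterraOp q k)^[n] f) t := fun t ht =>
    Summable.of_norm_bounded hu (fun n => hb n t ht)
  have hqx : IntervalIntegrable q volume 0 x := by
    refine hq.mono_set ?_
    rw [uIcc_of_le hx.1, uIcc_of_le hℓ]
    exact Icc_subset_Icc_right hx.2
  have hs := continuous_sinKernel k
  have key : HasSum (fun n => volterraOp q k ((volterraOp q k)^[n] f) x)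
      (∫ t in (0 : ℝ)..x, sinKernel k (x - t) * (q t : ℂ) * volterraSol q k f t) := by
    refine intervalIntegral.hasSum_integral_of_dominated_convergence
      (fun n t => (M * |q t|) * u n) (fun n => ?_) (fun n => ?_) ?_ ?_ ?_
    · have h := intervalIntegrable_sub (intervalIntegrable_mul hq hℓ
        ((by fun_prop : Continuous fun t : ℝ => sinKernel k (x - t)).continuousOn.mul
          (continuousOn_iterate (k := k) hq hf n))) hx
      refine (intervalIntegrable_iff.1 h).aestronglyMeasurable.congr (Filter.Eventually.of_forall fun t => ?_)
      simp only [Pi.mul_apply]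
      ring
    · refine Filter.Eventually.of_forall fun t ht => ?_
      rw [uIoc_of_le hx.1] at ht
      have h1 : ‖sinKernel k (x - t)‖ ≤ M :=
        hM _ ⟨by linarith [ht.2], by linarith [ht.1, hx.2]⟩
      rw [norm_mul, norm_mul, Complex.norm_real, Real.norm_eq_abs]
      gcongr
      exact hb n t ⟨ht.1.le, ht.2.trans hx.2⟩
    · exact Filter.Eventually.of_forall fun t _ => hu.mul_left _
    · simp_rw [tsum_mul_left]
      exact (hqx.abs.const_mul M).mul_const _
    · refine Filter.Eventually.of_forall fun t ht => ?_
      rw [uIoc_of_le hx.1] at ht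
      exact ((hsum t ⟨ht.1.le, ht.2.trans hx.2⟩).hasSum).mul_left _
  rw [volterraSol, (hsum x hx).tsum_eq_zero_add, ← key.tsum_eq]
  simp only [Function.iterate_succ_apply', Function.iterate_zero, id]

/-- The continuous solution of the Volterra equation is unique. -/
theorem volterraSol_unique (hq : IntervalIntegrable q volume 0 ℓ)
    (hf : ContinuousOn f (Icc 0 ℓ)) {y : ℝ → ℂ} (hy : ContinuousOn y (Icc 0 ℓ))
    (hye : ∀ x ∈ Icc 0 ℓ, y x = f x +
      ∫ t in (0 : ℝ)..x, sinKernel k (x - t) * (q t : ℂ) * y t) :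
    EqOn y (volterraSol q k f) (Icc 0 ℓ) := by
  have hv := continuousOn_volterraSol (k := k) hq hf
  set w : ℝ → ℂ := fun x => y x - volterraSol q k f x with hw
  have hwc : ContinuousOn w (Icc 0 ℓ) := hy.sub hv
  have hint : ∀ g : ℝ → ℂ, ContinuousOn g (Icc 0 ℓ) → ∀ x ∈ Icc 0 ℓ,
      IntervalIntegrable (fun t => sinKernel k (x - t) * (q t : ℂ) * g t) volume 0 x := by
    intro g hg x hx
    have hs := continuous_sinKernel k
    have h := intervalIntegrable_sub (intervalIntegrable_mul hq (hx.1.trans hx.2)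
      ((by fun_prop : Continuous fun t : ℝ => sinKernel k (x - t)).continuousOn.mul hg)) hx
    refine h.congr (fun t _ => ?_)
    simp only [Pi.mul_apply]
    ring
  have hfix : ∀ x ∈ Icc 0 ℓ, w x = volterraOp q k w x := by
    intro x hx
    simp only [hw, volterraOp, mul_sub]
    rw [intervalIntegral.integral_sub (hint y hy x hx) (hint _ hv x hx), hye x hx,
      volterraSol_eq hq hf hx]
    ring
  have hiter : ∀ n, ∀ x ∈ Icc 0 ℓ, ((volterraOp q k)^[n] w) x = w x := by
    intro n
    induction n with
    | zero => simp
    | succ n ih =>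
      intro x hx
      rw [Function.iterate_succ_apply', hfix x hx]
      unfold volterraOp
      refine intervalIntegral.integral_congr fun t ht => ?_
      rw [uIcc_of_le hx.1] at ht
      have := ih t ⟨ht.1, ht.2.trans hx.2⟩
      unfold volterraOp at this
      simp only [this]
  obtain ⟨u, hu, hb⟩ := exists_iterate_bound k hq hwc
  intro x hx
  have hle : ∀ n, ‖w x‖ ≤ u n := fun n => by rw [← hiter n x hx]; exact hb n x hx
  have h0 : ‖w x‖ ≤ 0 := ge_of_tendsto' hu.tendsto_atTop_zero hle
  exact sub_eq_zero.1 (norm_le_zero_iff.1 h0)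

end Volterra

/-- The solution `c(x, k)` of `-y'' + q y = k² y` with `c(0) = 1`, `c'(0) = 0`. -/
def cosSol (q : ℝ → ℝ) (k : ℂ) : ℝ → ℂ :=
  volterraSol q k (fun x => Complex.cos (k * x))

/-- The solution `s(x, k)` of `-y'' + q y = k² y` with `s(0) = 0`, `s'(0) = 1`. -/
def sinSol (q : ℝ → ℝ) (k : ℂ) : ℝ → ℂ :=
  volterraSol q k (sinKernel k)

theorem cosSol_eq {ℓ : ℝ} {q : ℝ → ℝ} (hq : MemW11 ℓ q) (k : ℂ) {x : ℝ} (hx : x ∈ Icc 0 ℓ) :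
    cosSol q k x = Complex.cos (k * x) +
      ∫ t in (0 : ℝ)..x, sinKernel k (x - t) * (q t : ℂ) * cosSol q k t :=
  volterraSol_eq (hq.intervalIntegrable (hx.1.trans hx.2))
    (by fun_prop : Continuous fun x : ℝ => Complex.cos (k * x)).continuousOn hx

theorem sinSol_eq {ℓ : ℝ} {q : ℝ → ℝ} (hq : MemW11 ℓ q) (k : ℂ) {x : ℝ} (hx : x ∈ Icc 0 ℓ) :
    sinSol q k x = sinKernel k x +
      ∫ t in (0 : ℝ)..x, sinKernel k (x - t) * (q t : ℂ) * sinSol q k t :=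
  volterraSol_eq (hq.intervalIntegrable (hx.1.trans hx.2))
    (continuous_sinKernel k).continuousOn hx

/-- The Hermitian matrix `H = -i (U + I)⁻¹ (U - I)`. The index `(j, 0)` is the beginning of
edge `j` and `(j, 1)` is its end. -/
def couplingH {d : ℕ} (U : Matrix (Fin d × Fin 2) (Fin d × Fin 2) ℂ) :
    Matrix (Fin d × Fin 2) (Fin d × Fin 2) ℂ :=
  (-Complex.I) • ((U + 1)⁻¹ * (U - 1))

/-- The matrix of boundary values. The column `(j, 0)` belongs to `c_j`, the column `(j, 1)`
to `s_j`. -/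
def M₁ {d : ℕ} (ℓ : Fin d → ℝ) (q : Fin d → ℝ → ℝ) (k : ℂ) :
    Matrix (Fin d × Fin 2) (Fin d × Fin 2) ℂ :=
  Matrix.of fun p r => if p.1 = r.1 then
    !![1, 0;
       cosSol (q p.1) k (ℓ p.1), sinSol (q p.1) k (ℓ p.1)] p.2 r.2 else 0

/-- The matrix of outgoing boundary derivatives (derivatives on the edge `[0, ℓ_j]`, one-sided at
its end points). -/
def M₂ {d : ℕ} (ℓ : Fin d → ℝ) (q : Fin d → ℝ → ℝ) (k : ℂ) :
    Matrix (Fin d × Fin 2) (Fin d × Fin 2) ℂ :=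
  Matrix.of fun p r => if p.1 = r.1 then
    !![0, 1;
       -derivWithin (cosSol (q p.1) k) (Icc 0 (ℓ p.1)) (ℓ p.1),
       -derivWithin (sinSol (q p.1) k) (Icc 0 (ℓ p.1)) (ℓ p.1)] p.2 r.2 else 0

/-- The secular function `φ(k) = det (H M₁(k) + M₂(k))`. -/
def secular {d : ℕ} (ℓ : Fin d → ℝ) (q : Fin d → ℝ → ℝ)
    (U : Matrix (Fin d × Fin 2) (Fin d × Fin 2) ℂ) (k : ℂ) : ℂ :=
  (couplingH U * M₁ ℓ q k + M₂ ℓ q k).det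

/-- The leading term `∏ᵢ (-k sin (k ℓᵢ))`. -/
def sineProduct {d : ℕ} (ℓ : Fin d → ℝ) (k : ℂ) : ℂ :=
  ∏ i, (-k * Complex.sin (k * ℓ i))

/-- The region inside the square contour with vertices `±N ± iN`. -/
def insideSquare (N : ℝ) : Set ℂ :=
  {z | |z.re| < N ∧ |z.im| < N}

/-- The zeros of `f` in `V`. -/
def zerosIn (f : ℂ → ℂ) (V : Set ℂ) : Set ℂ :=
  {z | z ∈ V ∧ f z = 0}

/-- The number of zeros in `V`, counted with multiplicity, of a function `f` that is holomorphic
near `V` and has finitely many zeros there. -/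
def zeroCount (f : ℂ → ℂ) (V : Set ℂ) : ℕ :=
  ∑ᶠ z ∈ zerosIn f V, analyticOrderNatAt f z

end QGraph

end

/-! On large admissible squares the secular function is asymptotic to the sine product, and Rouché's
theorem turns this into equality of the zero counts.

Write τ = |Im k|. Estimating the Volterra equations with the weight e^{τx} shows that c_j, s_j' and
s_j at ℓ_j are O(e^{τℓ_j}), while c_j'(ℓ_j) = -k sin(kℓ_j) + O(e^{τℓ_j})
(`isBigO_derivWithin_cosSol_sub`). If Nℓ_j keeps distance ε from all nπ, then |sin(kℓ_j)| is at
least a constant times e^{τℓ_j} on the contour once N is large (`isBigO_exp_sin`). There c_j'(ℓ_j)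
beats the numerators below by a factor of order |k|.

Factoring M₂ out on the right gives φ = det(H M₁ M₂⁻¹ + I) ∏ c_j'(ℓ_j) (`secular_eq_mul`). Because
the Wronskian is one, the j-th block of M₁ M₂⁻¹ has the entries -s_j', -1, -1, -c_j, all divided by
c_j'; it tends to 0 (`tendsto_weylInv`). So the determinant tends to 1, and the remaining product is
asymptotic to the sine product.

Entireness comes from the iterates of the Volterra operator, which are entire in k with a locally
uniformly convergent sum (`EntireFamily.volterraSol`). Rouché's theorem rests on an argument
principle obtained by dividing out the zeros one at a time. It needs only that the integral of 1/z
over the square is nonzero, not its value. -/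

noncomputable section

namespace QGraph

/-! ### Contour integrals over a square. -/

section Contour

open Filter Topology

/-- The boundary of the square with vertices `±N ± iN`. -/
def squareContour (N : ℝ) : Set ℂ :=
  {z | |z.re| ≤ N ∧ |z.im| ≤ N ∧ (|z.re| = N ∨ |z.im| = N)}

/-- The integral over the positively oriented boundary of the square with vertices `±N ± iN`. -/
def squareIntegral (N : ℝ) (f : ℂ → ℂ) : ℂ :=
  (∫ x : ℝ in -N..N, f (x + (-N : ℝ) * Complex.I)) - (∫ x : ℝ in -N..N, f (x + N * Complex.I)) +
    Complex.I * (∫ y : ℝ in -N..N, f (N + y * Complex.I)) -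
    Complex.I * (∫ y : ℝ in -N..N, f ((-N : ℝ) + y * Complex.I))

variable {N : ℝ} {f g : ℂ → ℂ}

lemma horizontal_mem_squareContour {b : ℝ} (hb : |b| = N) {x : ℝ} (hx : x ∈ Icc (-N) N) :
    (x + b * Complex.I : ℂ) ∈ squareContour N := by
  simp [squareContour, hb, abs_le.2 hx]

lemma vertical_mem_squareContour {a : ℝ} (ha : |a| = N) {y : ℝ} (hy : y ∈ Icc (-N) N) :
    (a + y * Complex.I : ℂ) ∈ squareContour N := by
  simp [squareContour, ha, abs_le.2 hy]

lemma intervalIntegrable_horizontal (hN : 0 ≤ N) (hf : ContinuousOn f (squareContour N)) {b : ℝ}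
    (hb : |b| = N) :
    IntervalIntegrable (fun x : ℝ => f (x + b * Complex.I)) volume (-N) N := by
  refine ContinuousOn.intervalIntegrable (hf.comp (by fun_prop) fun x hx => ?_)
  rw [uIcc_of_le (by linarith)] at hx
  exact horizontal_mem_squareContour hb hx

lemma intervalIntegrable_vertical (hN : 0 ≤ N) (hf : ContinuousOn f (squareContour N)) {a : ℝ}
    (ha : |a| = N) :
    IntervalIntegrable (fun y : ℝ => f (a + y * Complex.I)) volume (-N) N := by
  refine ContinuousOn.intervalIntegrable (hf.comp (by fun_prop) fun x hx => ?_)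
  rw [uIcc_of_le (by linarith)] at hx
  exact vertical_mem_squareContour ha hx

lemma squareIntegral_congr (hN : 0 ≤ N) (h : EqOn f g (squareContour N)) :
    squareIntegral N f = squareIntegral N g := by
  have e : uIcc (-N) N = Icc (-N) N := uIcc_of_le (by linarith)
  have hn : |N| = N := abs_of_nonneg hN
  have hn' : |-N| = N := by simpa
  have hor : ∀ b : ℝ, |b| = N → ∫ x : ℝ in -N..N, f (x + b * Complex.I) =
      ∫ x : ℝ in -N..N, g (x + b * Complex.I) := fun b hb =>
    intervalIntegral.integral_congr fun x hx => h (horizontal_mem_squareContour hb (e ▸ hx))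
  have ver : ∀ a : ℝ, |a| = N → ∫ y : ℝ in -N..N, f (a + y * Complex.I) =
      ∫ y : ℝ in -N..N, g (a + y * Complex.I) := fun a ha =>
    intervalIntegral.integral_congr fun y hy => h (vertical_mem_squareContour ha (e ▸ hy))
  unfold squareIntegral
  rw [hor _ hn', hor _ hn, ver _ hn, ver _ hn']

lemma squareIntegral_add (hN : 0 ≤ N) (hf : ContinuousOn f (squareContour N))
    (hg : ContinuousOn g (squareContour N)) :
    squareIntegral N (fun z => f z + g z) = squareIntegral N f + squareIntegral N g := by
  have hn : |N| = N := abs_of_nonneg hN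
  have hn' : |-N| = N := by simpa
  unfold squareIntegral
  rw [intervalIntegral.integral_add (intervalIntegrable_horizontal hN hf hn')
      (intervalIntegrable_horizontal hN hg hn'),
    intervalIntegral.integral_add (intervalIntegrable_horizontal hN hf hn)
      (intervalIntegrable_horizontal hN hg hn),
    intervalIntegral.integral_add (intervalIntegrable_vertical hN hf hn')
      (intervalIntegrable_vertical hN hg hn'),
    intervalIntegral.integral_add (intervalIntegrable_vertical hN hf hn)
      (intervalIntegrable_vertical hN hg hn)]
  ring

/-- The fundamental theorem of calculus on each side leaves corner values of the primitive, which
cancel around the square. -/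
lemma squareIntegral_of_hasDerivAt (hN : 0 ≤ N)
    (hf : ContinuousOn f (squareContour N))
    (h : ∀ z ∈ squareContour N, HasDerivAt g (f z) z) : squareIntegral N f = 0 := by
  have hn : |N| = N := abs_of_nonneg hN
  have hn' : |-N| = N := by simpa
  have e : uIcc (-N) N = Icc (-N) N := uIcc_of_le (by linarith)
  have hor : ∀ b : ℝ, |b| = N → ∫ x : ℝ in -N..N, f (x + b * Complex.I) =
      g (N + b * Complex.I) - g ((-N : ℝ) + b * Complex.I) := fun b hb => by
    refine intervalIntegral.integral_eq_sub_of_hasDerivAt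
      (f := fun x : ℝ => g (x + b * Complex.I)) (fun x hx => ?_)
      (intervalIntegrable_horizontal hN hf hb)
    have h1 : HasDerivAt (fun w : ℂ => w + b * Complex.I) 1 (x : ℂ) :=
      (hasDerivAt_id _).add_const _
    have h2 := (HasDerivAt.comp (x : ℂ)
      (h _ (horizontal_mem_squareContour hb (e ▸ hx))) h1).comp_ofReal
    simpa [Function.comp_def] using h2
  have ver : ∀ a : ℝ, |a| = N → Complex.I * ∫ y : ℝ in -N..N, f (a + y * Complex.I) =
      g (a + N * Complex.I) - g (a + (-N : ℝ) * Complex.I) := fun a ha => by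
    rw [← intervalIntegral.integral_const_mul]
    refine intervalIntegral.integral_eq_sub_of_hasDerivAt
      (f := fun y : ℝ => g (a + y * Complex.I)) (fun y hy => ?_)
      ((intervalIntegrable_vertical hN hf ha).const_mul _)
    have h1 : HasDerivAt (fun w : ℂ => a + w * Complex.I) Complex.I (y : ℂ) := by
      simpa using ((hasDerivAt_id (y : ℂ)).mul_const Complex.I).const_add (a : ℂ)
    have h2 := (HasDerivAt.comp (y : ℂ)
      (h _ (vertical_mem_squareContour ha (e ▸ hy))) h1).comp_ofReal
    simpa [Function.comp_def, mul_comm] using h2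
  unfold squareIntegral
  rw [hor _ hn', hor _ hn, ver _ hn, ver _ hn']
  ring

lemma continuousOn_logDeriv {s : Set ℂ} (hf : ∀ z ∈ s, AnalyticAt ℂ f z) (h0 : ∀ z ∈ s, f z ≠ 0) :
    ContinuousOn (logDeriv f) s := fun z hz =>
  (((hf z hz).deriv.continuousAt).div (hf z hz).continuousAt (h0 z hz)).continuousWithinAt

/-- A function whose values on the contour have a logarithm has winding number zero. -/
lemma squareIntegral_logDeriv_of_mem_slitPlane (hN : 0 ≤ N)
    (hf : ∀ z ∈ squareContour N, AnalyticAt ℂ f z)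
    (h : ∀ z ∈ squareContour N, f z ∈ Complex.slitPlane) :
    squareIntegral N (logDeriv f) = 0 :=
  squareIntegral_of_hasDerivAt hN
    (continuousOn_logDeriv hf fun z hz => Complex.slitPlane_ne_zero (h z hz))
    (fun z hz => (hf z hz).differentiableAt.hasDerivAt.clog (h z hz))

lemma squareIntegral_eq_zero_of_differentiableOn (hN : 0 ≤ N)
    (hf : DifferentiableOn ℂ f {z | |z.re| ≤ N ∧ |z.im| ≤ N}) : squareIntegral N f = 0 := by
  have h := Complex.integral_boundary_rect_eq_zero_of_differentiableOn f
    (-N + (-N : ℝ) * Complex.I) (N + N * Complex.I) (hf.mono fun z hz => ?_)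
  · simpa [squareIntegral] using h
  · have e : uIcc (-N) N = Icc (-N) N := uIcc_of_le (by linarith)
    simpa [Complex.mem_reProdIm, e, abs_le] using hz

lemma squareContour_ne_zero (hN : 0 < N) {z : ℂ} (hz : z ∈ squareContour N) : z ≠ 0 := by
  rintro rfl
  simp [squareContour] at hz
  linarith

/-- Pairing opposite sides turns the integral into `I` times the integral of a positive function.
Nonvanishing is enough, because the factor cancels in Rouché's theorem. -/
lemma squareIntegral_inv_ne_zero (hN : 0 < N) : squareIntegral N (fun z => z⁻¹) ≠ 0 := by
  have hc : ContinuousOn (fun z : ℂ => z⁻¹) (squareContour N) :=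
    continuousOn_inv₀.mono fun z hz => squareContour_ne_zero hN hz
  have hn : |N| = N := abs_of_nonneg hN.le
  have hn' : |-N| = N := by rwa [abs_neg]
  have hp : ∀ x : ℝ, (x : ℂ) ^ 2 + (N : ℂ) ^ 2 ≠ 0 := fun x => by
    have : x ^ 2 + N ^ 2 ≠ 0 := by positivity
    exact_mod_cast this
  have fac : ∀ x : ℝ, (x : ℂ) ^ 2 + (N : ℂ) ^ 2 = (x + (-N : ℝ) * Complex.I) * (x + N * Complex.I) :=
    fun x => by
      push_cast
      ring_nf
      simp
  have key : squareIntegral N (fun z => z⁻¹) =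
      Complex.I * ((∫ x in -N..N, 4 * N / (x ^ 2 + N ^ 2) : ℝ) : ℂ) := by
    unfold squareIntegral
    rw [← intervalIntegral.integral_sub (intervalIntegrable_horizontal hN.le hc hn')
        (intervalIntegrable_horizontal hN.le hc hn), add_sub_assoc, ← mul_sub,
      ← intervalIntegral.integral_sub (intervalIntegrable_vertical hN.le hc hn)
        (intervalIntegrable_vertical hN.le hc hn')]
    have e1 : ∀ x : ℝ, (x + (-N : ℝ) * Complex.I : ℂ)⁻¹ - (x + N * Complex.I : ℂ)⁻¹ =
        Complex.I * ((2 * N / (x ^ 2 + N ^ 2) : ℝ) : ℂ) := fun x => by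
      have h := hp x
      rw [fac] at h
      rw [inv_sub_inv (left_ne_zero_of_mul h) (right_ne_zero_of_mul h), ← fac]
      push_cast
      ring
    have e2 : ∀ y : ℝ, (N + y * Complex.I : ℂ)⁻¹ - ((-N : ℝ) + y * Complex.I : ℂ)⁻¹ =
        ((2 * N / (y ^ 2 + N ^ 2) : ℝ) : ℂ) := fun y => by
      have f' : (N + y * Complex.I : ℂ) * ((-N : ℝ) + y * Complex.I : ℂ) =
          -((y : ℂ) ^ 2 + (N : ℂ) ^ 2) := by
        push_cast
        ring_nf
        simp
        ring
      have h := neg_ne_zero.2 (hp y)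
      rw [← f'] at h
      rw [inv_sub_inv (left_ne_zero_of_mul h) (right_ne_zero_of_mul h), f']
      push_cast
      rw [div_neg, ← neg_div]
      ring
    simp_rw [e1, e2]
    rw [intervalIntegral.integral_const_mul, ← mul_add, intervalIntegral.integral_ofReal,
      ← Complex.ofReal_add, ← two_mul, ← intervalIntegral.integral_const_mul]
    congr 3
    ext x
    ring
  rw [key]
  refine mul_ne_zero Complex.I_ne_zero (Complex.ofReal_ne_zero.2 (ne_of_gt ?_))
  refine intervalIntegral.intervalIntegral_pos_of_pos_on ?_ (fun x _ => by positivity) (by linarith)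
  refine Continuous.intervalIntegrable (Continuous.div (by fun_prop) (by fun_prop) fun x => ?_) _ _
  positivity

lemma insideSquare_smul {w : ℂ} (hw : w ∈ insideSquare N) {t : ℝ} (h0 : 0 ≤ t) (h1 : t ≤ 1) :
    (t : ℂ) * w ∈ insideSquare N := by
  simp only [insideSquare, mem_ofPred_eq, Complex.re_ofReal_mul, Complex.im_ofReal_mul, abs_mul,
    abs_of_nonneg h0] at *
  constructor
  · nlinarith [abs_nonneg w.re]
  · nlinarith [abs_nonneg w.im]

lemma squareContour_disjoint_insideSquare {z : ℂ} (hz : z ∈ squareContour N) :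
    z ∉ insideSquare N := fun h => by
  rcases hz.2.2 with h' | h'
  · exact h.1.ne h'
  · exact h.2.ne h'

/-- The two integrands differ by the logarithmic derivative of (z - w)/z, which has a logarithm on
the contour: if (z - w)/z = r ≤ 0, then z = w/(1 - r) lies on the segment from 0 to w, hence inside
the square. -/
lemma squareIntegral_inv_sub (hN : 0 < N) {w : ℂ} (hw : w ∈ insideSquare N) :
    squareIntegral N (fun z => (z - w)⁻¹) = squareIntegral N (fun z => z⁻¹) := by
  have hne : ∀ z ∈ squareContour N, z - w ≠ 0 := fun z hz h => by
    rw [sub_eq_zero] at h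
    exact squareContour_disjoint_insideSquare hz (h ▸ hw)
  have hne0 : ∀ z ∈ squareContour N, z ≠ 0 := fun z hz => squareContour_ne_zero hN hz
  have hz := squareIntegral_logDeriv_of_mem_slitPlane (f := fun z => (z - w) / z) hN.le
    (fun z hz => by
      have := hne0 z hz
      fun_prop (disch := assumption)) (fun z hz => by
      by_contra hs
      have h0 := hne0 z hz
      rw [Complex.mem_slitPlane_iff] at hs
      push Not at hs
      have hr : (z - w) / z = (((z - w) / z).re : ℂ) := Complex.ext (by simp) (by simp [hs.2])
      set r := ((z - w) / z).re with hrdef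
      rw [div_eq_iff h0] at hr
      have hw' : w = ((1 - r : ℝ) : ℂ) * z := by
        push_cast
        linear_combination -hr
      have h1 : (1 - r) ≠ 0 := by linarith [hs.1]
      refine squareContour_disjoint_insideSquare hz ?_
      have : z = (((1 - r)⁻¹ : ℝ) : ℂ) * w := by
        rw [hw', ← mul_assoc, ← Complex.ofReal_mul, inv_mul_cancel₀ h1]
        simp
      rw [this]
      exact insideSquare_smul hw (inv_nonneg.2 (by linarith [hs.1]))
        (inv_le_one_of_one_le₀ (by linarith [hs.1])))
  have e : EqOn (fun z => (z - w)⁻¹)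
      (fun z => logDeriv (fun z => (z - w) / z) z + z⁻¹) (squareContour N) := fun z hz => by
    have h := logDeriv_div (f := fun z => z - w) (g := fun z : ℂ => z) z (hne z hz) (hne0 z hz)
      (by fun_prop) (by fun_prop)
    simp only [h, logDeriv_apply]
    simp
  rw [squareIntegral_congr hN.le e, squareIntegral_add hN.le, hz, zero_add]
  · refine continuousOn_logDeriv (fun z hz => ?_) fun z hz => div_ne_zero (hne z hz) (hne0 z hz)
    have := hne0 z hz
    fun_prop (disch := assumption)
  · exact continuousOn_inv₀.mono fun z hz => hne0 z hz

lemma insideSquare_subset_compact :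
    insideSquare N ⊆ (Icc (-N) N) ×ℂ (Icc (-N) N) := fun _ hz =>
  ⟨abs_le.1 hz.1.le, abs_le.1 hz.2.le⟩

/-! ### Counting zeros: the argument principle and Rouché's theorem. -/

lemma finite_zerosIn_insideSquare (hf : Differentiable ℂ f) {w : ℂ} (hw : f w ≠ 0) :
    (zerosIn f (insideSquare N)).Finite := by
  by_contra hinf
  obtain ⟨x, -, hx⟩ := Set.Infinite.exists_accPt_of_subset_isCompact hinf
    (isCompact_Icc.reProdIm isCompact_Icc) (fun z hz => insideSquare_subset_compact hz.1)
  have hfr : ∃ᶠ z in 𝓝[≠] x, f z = 0 := by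
    rw [accPt_iff_frequently_nhdsNE] at hx
    exact hx.mono fun z hz => hz.2
  have := AnalyticOnNhd.eqOn_zero_of_preconnected_of_frequently_eq_zero
    (fun z _ => hf.analyticAt z) isPreconnected_univ (mem_univ x) hfr
  exact hw (this (mem_univ w))

/-- Points of `S` that are not zeros have order 0. This lets a function and its quotient by a linear
factor be counted over the same finite set. -/
lemma zeroCount_eq_sum {V : Set ℂ} (S : Finset ℂ) (hS : ↑S ⊆ V) (h : zerosIn f V ⊆ S) :
    zeroCount f V = ∑ z ∈ S, analyticOrderNatAt f z := by
  refine finsum_mem_eq_sum_of_inter_support_eq _ (Subset.antisymm ?_ ?_)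
  · exact inter_subset_inter_left _ h
  · rintro z ⟨hz, hz'⟩
    exact ⟨⟨hS hz, apply_eq_zero_of_analyticOrderNatAt_ne_zero hz'⟩, hz'⟩

lemma differentiable_dslope (hf : Differentiable ℂ f) (w : ℂ) : Differentiable ℂ (dslope f w) := by
  rw [← differentiableOn_univ] at *
  exact (Complex.differentiableOn_dslope univ_mem).2 hf

/-- Infinite order at one point would force `f` to vanish identically. It must be excluded because
`analyticOrderNatAt` reads infinite order as 0. -/
lemma analyticOrderAt_ne_top_of_ne_zero (hf : Differentiable ℂ f) {w : ℂ} (hw : f w ≠ 0) (z : ℂ) :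
    analyticOrderAt f z ≠ ⊤ := fun h => by
  have := AnalyticOnNhd.eqOn_zero_of_preconnected_of_frequently_eq_zero
    (fun z _ => hf.analyticAt z) isPreconnected_univ (mem_univ z)
    ((analyticOrderAt_eq_top.1 h).filter_mono nhdsWithin_le_nhds).frequently
  exact hw (this (mem_univ w))

lemma eq_sub_mul_dslope {w : ℂ} (hw : f w = 0) : f = (fun z => z - w) * dslope f w := by
  ext z
  have := sub_smul_dslope f w z
  simp only [hw, sub_zero, smul_eq_mul] at this
  simp [this]

/-- The argument principle for an entire function on a square. -/
theorem squareIntegral_logDeriv (hN : 0 < N) (hf : Differentiable ℂ f)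
    (h0 : ∀ z ∈ squareContour N, f z ≠ 0) :
    squareIntegral N (logDeriv f) =
      zeroCount f (insideSquare N) * squareIntegral N (fun z => z⁻¹) := by
  -- Induction on the number of zeros: without zeros this is Cauchy's theorem; otherwise f = (z - w)
  -- g with one zero fewer, and the logarithmic derivative splits off 1/(z - w).
  induction hn : zeroCount f (insideSquare N) generalizing f with
  | zero =>
    have hNm : (N : ℂ) ∈ squareContour N := by simp [squareContour, abs_of_pos hN, hN.le]
    have hfin := finite_zerosIn_insideSquare (N := N) hf (h0 _ hNm)
    have hz : ∀ z : ℂ, |z.re| ≤ N → |z.im| ≤ N → f z ≠ 0 := by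
      intro z h1 h2 hfz
      by_cases hin : z ∈ insideSquare N
      · rw [zeroCount_eq_sum hfin.toFinset (by simp [zerosIn]) (by simp),
          Finset.sum_eq_zero_iff] at hn
        have h3 := hn z (by simp [zerosIn, hin, hfz])
        have h4 := (Nat.cast_analyticOrderNatAt
          (analyticOrderAt_ne_top_of_ne_zero hf (h0 _ hNm) z)).symm
        rw [h3, Nat.cast_zero, (hf.analyticAt z).analyticOrderAt_eq_zero] at h4
        exact h4 hfz
      · refine h0 z ⟨h1, h2, ?_⟩ hfz
        by_contra hcon
        push Not at hcon
        exact hin ⟨lt_of_le_of_ne h1 hcon.1, lt_of_le_of_ne h2 hcon.2⟩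
    rw [squareIntegral_eq_zero_of_differentiableOn hN.le]
    · simp
    · intro z hz'
      exact ((hf.analyticAt z).deriv.differentiableAt.div (hf z)
        (hz z hz'.1 hz'.2)).differentiableWithinAt
  | succ n ih =>
    have hNm : (N : ℂ) ∈ squareContour N := by simp [squareContour, abs_of_pos hN, hN.le]
    have hfin := finite_zerosIn_insideSquare (N := N) hf (h0 _ hNm)
    have hsum := zeroCount_eq_sum (f := f) (V := insideSquare N) hfin.toFinset (by simp [zerosIn]) (by simp)
    obtain ⟨w, hwS⟩ : hfin.toFinset.Nonempty := by
      by_contra hemp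
      rw [Finset.not_nonempty_iff_eq_empty] at hemp
      rw [hemp, Finset.sum_empty] at hsum
      omega
    have hw : w ∈ zerosIn f (insideSquare N) := by simpa using hwS
    have hfac := eq_sub_mul_dslope hw.2
    set g := dslope f w with hg
    have hgd : Differentiable ℂ g := differentiable_dslope hf w
    have hg0 : ∀ z, f z ≠ 0 → g z ≠ 0 := fun z hz h => hz (by rw [hfac]; simp [h])
    have hmem : ∀ z, g z = 0 → f z = 0 := fun z hz => by rw [hfac]; simp [hz]
    have hsumg := zeroCount_eq_sum (f := g) (V := insideSquare N) hfin.toFinset (by simp [zerosIn])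
      (fun z hz => by simpa using ⟨hz.1, hmem z hz.2⟩)
    have hlin : ∀ z, analyticOrderNatAt (fun z => z - w) z = if z = w then 1 else 0 := by
      intro z
      unfold analyticOrderNatAt
      split_ifs with h
      · subst h
        exact congrArg ENat.toNat (analyticOrderAt_id_sub_const_self (𝕜 := ℂ) (c := z))
      · exact congrArg ENat.toNat (analyticOrderAt_id_sub_const_of_ne (𝕜 := ℂ) h)
    have hord : ∀ z, analyticOrderNatAt f z = (if z = w then 1 else 0) + analyticOrderNatAt g z := by
      intro z
      conv_lhs => rw [hfac]
      rw [analyticOrderNatAt_mul (by fun_prop) (hgd.analyticAt z) _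
        (analyticOrderAt_ne_top_of_ne_zero hgd (hg0 _ (h0 _ hNm)) z), hlin]
      -- The factor z - w takes the value 1 at w + 1, so it is not identically zero.
      exact analyticOrderAt_ne_top_of_ne_zero (w := w + 1) (by fun_prop) (by simp) z
    have hcount : zeroCount g (insideSquare N) = n := by
      simp_rw [hord, Finset.sum_add_distrib] at hsum
      rw [Finset.sum_ite_eq' _ w, if_pos hwS, ← hsumg, hn] at hsum
      omega
    have hgc : ∀ z ∈ squareContour N, g z ≠ 0 := fun z hz => hg0 z (h0 z hz)
    have hwc : ∀ z ∈ squareContour N, z - w ≠ 0 := fun z hz h => by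
      rw [sub_eq_zero] at h
      exact squareContour_disjoint_insideSquare hz (h ▸ hw.1)
    have e : EqOn (logDeriv f) (fun z => (z - w)⁻¹ + logDeriv g z) (squareContour N) := by
      intro z hz
      have h := logDeriv_mul (f := fun z => z - w) (g := g) z (hwc z hz) (hgc z hz)
        (by fun_prop) (hgd z)
      have h' : f = fun z => (z - w) * g z := hfac
      rw [h', h]
      simp [logDeriv_apply]
    rw [squareIntegral_congr hN.le e, squareIntegral_add hN.le, squareIntegral_inv_sub hN hw.1,
      ih hgd hgc hcount]
    · push_cast
      ring
    · exact ContinuousOn.inv₀ (by fun_prop) hwc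
    · exact continuousOn_logDeriv (fun z _ => hgd.analyticAt z) hgc

/-- **Rouché's theorem** for entire functions on a square. -/
theorem zeroCount_eq_of_norm_sub_lt (hN : 0 < N) (hf : Differentiable ℂ f)
    (hg : Differentiable ℂ g) (h : ∀ z ∈ squareContour N, ‖f z - g z‖ < ‖g z‖) :
    (zerosIn f (insideSquare N)).Finite ∧ (zerosIn g (insideSquare N)).Finite ∧
      zeroCount f (insideSquare N) = zeroCount g (insideSquare N) := by
  have hNm : (N : ℂ) ∈ squareContour N := by simp [squareContour, abs_of_pos hN, hN.le]
  have hg0 : ∀ z ∈ squareContour N, g z ≠ 0 := fun z hz h' => by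
    have := h z hz
    rw [h', norm_zero] at this
    exact absurd (norm_nonneg _) (not_le.2 this)
  have hf0 : ∀ z ∈ squareContour N, f z ≠ 0 := fun z hz h' => by
    have := h z hz
    simp [h'] at this
  refine ⟨finite_zerosIn_insideSquare hf (hf0 _ hNm), finite_zerosIn_insideSquare hg (hg0 _ hNm),
    ?_⟩
  have han : ∀ z ∈ squareContour N, AnalyticAt ℂ (fun z => f z / g z) z := fun z hz =>
    (hf.analyticAt z).div (hg.analyticAt z) (hg0 z hz)
  have hz := squareIntegral_logDeriv_of_mem_slitPlane (f := fun z => f z / g z) hN.le han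
    (fun z hz => by
      -- The quotient lies in the disc of radius 1 about 1, which avoids the cut of the logarithm;
      -- hence f and g have equal logarithmic integrals.
      have e : f z / g z = 1 + (f z - g z) / g z := by
        have := hg0 z hz
        field_simp
        ring
      rw [e]
      refine Complex.mem_slitPlane_of_norm_lt_one ?_
      rw [norm_div, div_lt_one (norm_pos_iff.2 (hg0 z hz))]
      exact h z hz)
  have e : EqOn (logDeriv f) (fun z => logDeriv (fun z => f z / g z) z + logDeriv g z)
      (squareContour N) := fun z hz => by
    simp only [logDeriv_div z (hf0 z hz) (hg0 z hz) (hf z) (hg z), sub_add_cancel]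
  have hI := squareIntegral_congr hN.le e
  rw [squareIntegral_add hN.le
    (continuousOn_logDeriv han fun z hz => div_ne_zero (hf0 z hz) (hg0 z hz))
    (continuousOn_logDeriv (fun z _ => hg.analyticAt z) hg0), hz, zero_add,
    squareIntegral_logDeriv hN hf hf0, squareIntegral_logDeriv hN hg hg0] at hI
  exact_mod_cast mul_right_cancel₀ (squareIntegral_inv_ne_zero hN) hI

end Contour

/-! ### Derivatives of the fundamental solutions at the end point, and the Wronskian. -/

section Derivative

variable {ℓ : ℝ} {q : ℝ → ℝ} {k : ℂ} {y : ℝ → ℂ}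

/-- Increments of the primitive are dominated by those of the primitive of the norm, so the
real-valued case carries over. -/
lemma absolutelyContinuousOnInterval_primitive {h : ℝ → ℂ} {a b : ℝ}
    (hh : IntervalIntegrable h volume a b) :
    AbsolutelyContinuousOnInterval (fun x => ∫ t in a..x, h t) a b := by
  have hG := hh.norm.absolutelyContinuousOnInterval_intervalIntegral left_mem_uIcc
  refine squeeze_zero' (Filter.Eventually.of_forall fun E =>
    Finset.sum_nonneg fun _ _ => dist_nonneg) ?_ hG
  -- The principal part of the filter records that the end points of the subintervals lie in `uIcc a
  -- b`.
  filter_upwards [Filter.mem_inf_of_right (Filter.mem_principal_self _)] with E hE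
  refine Finset.sum_le_sum fun i hi => ?_
  obtain ⟨h1, h2⟩ := hE.1 i hi
  have hsub : ∀ u ∈ uIcc a b, IntervalIntegrable h volume a u := fun u hu =>
    hh.mono_set (uIcc_subset_uIcc left_mem_uIcc hu)
  rw [dist_eq_norm, dist_eq_norm, intervalIntegral.integral_interval_sub_left (hsub _ h1) (hsub _ h2),
    intervalIntegral.integral_interval_sub_left (hsub _ h1).norm (hsub _ h2).norm, Real.norm_eq_abs]
  exact intervalIntegral.norm_integral_le_abs_integral_norm

lemma hasDerivAt_cos_mul (k : ℂ) (x : ℝ) :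
    HasDerivAt (fun x : ℝ => Complex.cos (k * x)) (-(k ^ 2 * sinKernel k x)) x := by
  have h1 : HasDerivAt (fun w : ℂ => k * w) k (x : ℂ) := by
    simpa using (hasDerivAt_id (x : ℂ)).const_mul k
  have h2 := h1.ccos.comp_ofReal
  convert h2 using 1
  unfold sinKernel
  split_ifs with h
  · simp [h]
  · field_simp

lemma hasDerivAt_sinKernel (k : ℂ) (x : ℝ) :
    HasDerivAt (sinKernel k) (Complex.cos (k * x)) x := by
  unfold sinKernel
  split_ifs with h
  · simpa [h] using (hasDerivAt_id (x : ℂ)).comp_ofReal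
  · have h1 : HasDerivAt (fun w : ℂ => k * w) k (x : ℂ) := by
      simpa using (hasDerivAt_id (x : ℂ)).const_mul k
    have h2 := (h1.csin.div_const k).comp_ofReal
    simpa [h] using h2

lemma contDiff_cos_mul (k : ℂ) : ContDiff ℝ 1 fun x : ℝ => Complex.cos (k * x) := by
  have : ContDiff ℝ 1 fun x : ℝ => k * (x : ℂ) :=
    contDiff_const.mul Complex.ofRealCLM.contDiff
  exact (Complex.contDiff_cos.restrict_scalars ℝ).comp this

lemma contDiff_sinKernel (k : ℂ) : ContDiff ℝ 1 (sinKernel k) := by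
  rw [contDiff_one_iff_deriv]
  refine ⟨fun x => (hasDerivAt_sinKernel k x).differentiableAt, ?_⟩
  rw [show deriv (sinKernel k) = fun x : ℝ => Complex.cos (k * x) from
    funext fun x => (hasDerivAt_sinKernel k x).deriv]
  fun_prop

lemma cos_sq_add_sinKernel_sq (k : ℂ) (x : ℝ) :
    Complex.cos (k * x) ^ 2 + k ^ 2 * sinKernel k x ^ 2 = 1 := by
  unfold sinKernel
  split_ifs with h
  · simp [h]
  · rw [div_pow, mul_div_cancel₀ _ (pow_ne_zero 2 h), Complex.cos_sq_add_sin_sq]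

/-- The primitive `∫₀ˣ cos (k t) q(t) y(t) dt`. -/
def cosMoment (q : ℝ → ℝ) (k : ℂ) (y : ℝ → ℂ) (x : ℝ) : ℂ :=
  ∫ t in (0 : ℝ)..x, (q t : ℂ) * (Complex.cos (k * t) * y t)

/-- The primitive `∫₀ˣ (sin (k t) / k) q(t) y(t) dt`. -/
def sinMoment (q : ℝ → ℝ) (k : ℂ) (y : ℝ → ℂ) (x : ℝ) : ℂ :=
  ∫ t in (0 : ℝ)..x, (q t : ℂ) * (sinKernel k t * y t)

/-- The derivative in `x` of `volterraOp q k y x`. -/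
def volterraDeriv (q : ℝ → ℝ) (k : ℂ) (y : ℝ → ℂ) (x : ℝ) : ℂ :=
  ∫ t in (0 : ℝ)..x, Complex.cos (k * (x - t : ℝ)) * (q t : ℂ) * y t

@[simp]
lemma cosMoment_zero (q : ℝ → ℝ) (k : ℂ) (y : ℝ → ℂ) : cosMoment q k y 0 = 0 := by
  simp [cosMoment]

@[simp]
lemma sinMoment_zero (q : ℝ → ℝ) (k : ℂ) (y : ℝ → ℂ) : sinMoment q k y 0 = 0 := by
  simp [sinMoment]

lemma intervalIntegrable_cosMoment (hℓ : 0 ≤ ℓ) (hq : IntervalIntegrable q volume 0 ℓ)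
    (hy : ContinuousOn y (Icc 0 ℓ)) :
    IntervalIntegrable (fun t => (q t : ℂ) * (Complex.cos (k * t) * y t)) volume 0 ℓ :=
  intervalIntegrable_mul hq hℓ
    ((by fun_prop : Continuous fun t : ℝ => Complex.cos (k * t)).continuousOn.mul hy)

lemma intervalIntegrable_sinMoment (hℓ : 0 ≤ ℓ) (hq : IntervalIntegrable q volume 0 ℓ)
    (hy : ContinuousOn y (Icc 0 ℓ)) :
    IntervalIntegrable (fun t => (q t : ℂ) * (sinKernel k t * y t)) volume 0 ℓ :=
  intervalIntegrable_mul hq hℓ ((continuous_sinKernel k).continuousOn.mul hy)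

lemma continuousOn_primitive_Icc {h : ℝ → ℂ} (hℓ : 0 ≤ ℓ) (hh : IntervalIntegrable h volume 0 ℓ) :
    ContinuousOn (fun x => ∫ t in (0 : ℝ)..x, h t) (Icc 0 ℓ) := by
  have := intervalIntegral.continuousOn_primitive_interval' hh left_mem_uIcc
  rwa [uIcc_of_le hℓ] at this

lemma volterraDeriv_expand (hq : IntervalIntegrable q volume 0 ℓ) (hy : ContinuousOn y (Icc 0 ℓ))
    {x : ℝ} (hx : x ∈ Icc 0 ℓ) :
    volterraDeriv q k y x =
      Complex.cos (k * x) * cosMoment q k y x + k ^ 2 * sinKernel k x * sinMoment q k y x := by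
  have hℓ : 0 ≤ ℓ := hx.1.trans hx.2
  unfold cosMoment sinMoment
  rw [← intervalIntegral.integral_const_mul, ← intervalIntegral.integral_const_mul,
    ← intervalIntegral.integral_add
      ((intervalIntegrable_sub (intervalIntegrable_cosMoment hℓ hq hy) hx).const_mul _)
      ((intervalIntegrable_sub (intervalIntegrable_sinMoment hℓ hq hy) hx).const_mul _)]
  unfold volterraDeriv
  congr 1
  ext t
  have hs : ∀ u : ℝ, Complex.sin (k * u) = k * sinKernel k u := fun u => by
    unfold sinKernel
    split_ifs with h
    · simp [h]
    · field_simp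
  push_cast
  rw [mul_sub, Complex.cos_sub, hs, hs]
  ring

/-- For integrable q the moments are differentiable only almost everywhere. The difference of the
two sides is absolutely continuous; in its derivative the terms containing q cancel, so it is
constant, and it vanishes at 0. -/
lemma volterraOp_eq_integral_volterraDeriv (hq : IntervalIntegrable q volume 0 ℓ)
    (hy : ContinuousOn y (Icc 0 ℓ)) {x : ℝ} (hx : x ∈ Icc 0 ℓ) :
    volterraOp q k y x = ∫ t in (0 : ℝ)..x,
      (Complex.cos (k * t) * cosMoment q k y t + k ^ 2 * sinKernel k t * sinMoment q k y t) := by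
  have hℓ : 0 ≤ ℓ := hx.1.trans hx.2
  have hA := intervalIntegrable_cosMoment (k := k) hℓ hq hy
  have hB := intervalIntegrable_sinMoment (k := k) hℓ hq hy
  have hAc : ContinuousOn (cosMoment q k y) (Icc 0 ℓ) := continuousOn_primitive_Icc hℓ hA
  have hBc : ContinuousOn (sinMoment q k y) (Icc 0 ℓ) := continuousOn_primitive_Icc hℓ hB
  have hC : Continuous fun x : ℝ => Complex.cos (k * x) := by fun_prop
  have hS := continuous_sinKernel k
  have hD : IntervalIntegrable (fun t : ℝ => Complex.cos (k * t) * cosMoment q k y t +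
      k ^ 2 * sinKernel k t * sinMoment q k y t) volume 0 ℓ := by
    refine ContinuousOn.intervalIntegrable ?_
    rw [uIcc_of_le hℓ]
    exact (hC.continuousOn.mul hAc).add ((continuous_const.mul hS).continuousOn.mul hBc)
  have hac : AbsolutelyContinuousOnInterval (fun x =>
      sinKernel k x * cosMoment q k y x - Complex.cos (k * x) * sinMoment q k y x -
        ∫ t in (0 : ℝ)..x, (Complex.cos (k * t) * cosMoment q k y t +
          k ^ 2 * sinKernel k t * sinMoment q k y t)) 0 ℓ :=
    (((contDiff_sinKernel k).contDiffOn.absolutelyContinuousOnInterval.smul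
      (absolutelyContinuousOnInterval_primitive hA)).sub
      ((contDiff_cos_mul k).contDiffOn.absolutelyContinuousOnInterval.smul
      (absolutelyContinuousOnInterval_primitive hB))).sub
      (absolutelyContinuousOnInterval_primitive hD)
  obtain ⟨c, hc⟩ := hac.const_of_ae_hasDerivAt_zero (by
    filter_upwards [hA.ae_hasDerivAt_integral, hB.ae_hasDerivAt_integral,
      hD.ae_hasDerivAt_integral] with t h1 h2 h3 ht
    have d1 : HasDerivAt (cosMoment q k y) _ t := h1 ht 0 left_mem_uIcc
    have d2 : HasDerivAt (sinMoment q k y) _ t := h2 ht 0 left_mem_uIcc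
    refine ((((hasDerivAt_sinKernel k t).fun_mul d1).fun_sub
      ((hasDerivAt_cos_mul k t).fun_mul d2)).fun_sub (h3 ht 0 left_mem_uIcc)).congr_deriv ?_
    ring)
  rw [uIcc_of_le hℓ] at hc
  have hx' := (hc x hx).trans (hc 0 ⟨le_rfl, hℓ⟩).symm
  simp only [cosMoment_zero, sinMoment_zero, intervalIntegral.integral_same, mul_zero, sub_zero,
    sub_eq_zero] at hx'
  rw [volterraOp_expand hq hy hx]
  exact hx'

/-- The preceding formula has a continuous integrand, so the derivative exists at every point. The
end point ℓ is the one that enters M₂. -/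
lemma hasDerivWithinAt_volterraOp (hq : IntervalIntegrable q volume 0 ℓ)
    (hy : ContinuousOn y (Icc 0 ℓ)) {x : ℝ} (hx : x ∈ Icc 0 ℓ) :
    HasDerivWithinAt (volterraOp q k y) (volterraDeriv q k y x) (Icc 0 ℓ) x := by
  have hℓ : 0 ≤ ℓ := hx.1.trans hx.2
  have hAc : ContinuousOn (cosMoment q k y) (Icc 0 ℓ) :=
    continuousOn_primitive_Icc hℓ (intervalIntegrable_cosMoment hℓ hq hy)
  have hBc : ContinuousOn (sinMoment q k y) (Icc 0 ℓ) :=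
    continuousOn_primitive_Icc hℓ (intervalIntegrable_sinMoment hℓ hq hy)
  have hC : Continuous fun x : ℝ => Complex.cos (k * x) := by fun_prop
  have hS := continuous_sinKernel k
  have hD : ContinuousOn (fun t : ℝ => Complex.cos (k * t) * cosMoment q k y t +
      k ^ 2 * sinKernel k t * sinMoment q k y t) (Icc 0 ℓ) :=
    (hC.continuousOn.mul hAc).add ((continuous_const.mul hS).continuousOn.mul hBc)
  -- This makes the `FTCFilter` instance for neighbourhoods within `Icc 0 ℓ` available.
  have : Fact (x ∈ Icc 0 ℓ) := ⟨hx⟩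
  have h := intervalIntegral.integral_hasDerivWithinAt_right (s := Icc 0 ℓ) (t := Icc 0 ℓ)
    (intervalIntegrable_sub (hD.intervalIntegrable_of_Icc hℓ) hx)
    (hD.stronglyMeasurableAtFilter_nhdsWithin measurableSet_Icc x) (hD x hx)
  rw [← volterraDeriv_expand hq hy hx] at h
  exact h.congr_of_mem (fun z hz => volterraOp_eq_integral_volterraDeriv hq hy hz) hx

lemma derivWithin_volterraSol (hℓ : 0 < ℓ) (hq : IntervalIntegrable q volume 0 ℓ) {f : ℝ → ℂ}
    {f' : ℂ} (hf : ContinuousOn f (Icc 0 ℓ)) (hf' : HasDerivAt f f' ℓ) :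
    derivWithin (volterraSol q k f) (Icc 0 ℓ) ℓ =
      f' + volterraDeriv q k (volterraSol q k f) ℓ := by
  have hmem : ℓ ∈ Icc 0 ℓ := ⟨hℓ.le, le_rfl⟩
  have h := hf'.hasDerivWithinAt.add
    (hasDerivWithinAt_volterraOp (k := k) hq (continuousOn_volterraSol (k := k) hq hf) hmem)
  exact (h.congr_of_mem (fun z hz => volterraSol_eq hq hf hz) hmem).derivWithin
    (uniqueDiffOn_Icc hℓ ℓ hmem)

lemma derivWithin_cosSol (hℓ : 0 < ℓ) (hq : IntervalIntegrable q volume 0 ℓ) (k : ℂ) :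
    derivWithin (cosSol q k) (Icc 0 ℓ) ℓ =
      -(k ^ 2 * sinKernel k ℓ) + volterraDeriv q k (cosSol q k) ℓ :=
  derivWithin_volterraSol hℓ hq
    (by fun_prop : Continuous fun x : ℝ => Complex.cos (k * x)).continuousOn
    (hasDerivAt_cos_mul k ℓ)

lemma derivWithin_sinSol (hℓ : 0 < ℓ) (hq : IntervalIntegrable q volume 0 ℓ) (k : ℂ) :
    derivWithin (sinSol q k) (Icc 0 ℓ) ℓ =
      Complex.cos (k * ℓ) + volterraDeriv q k (sinSol q k) ℓ :=
  derivWithin_volterraSol hℓ hq (continuous_sinKernel k).continuousOn (hasDerivAt_sinKernel k ℓ)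

lemma continuousOn_cosSol (hq : IntervalIntegrable q volume 0 ℓ) (k : ℂ) :
    ContinuousOn (cosSol q k) (Icc 0 ℓ) :=
  continuousOn_volterraSol hq
    (by fun_prop : Continuous fun x : ℝ => Complex.cos (k * x)).continuousOn

lemma continuousOn_sinSol (hq : IntervalIntegrable q volume 0 ℓ) (k : ℂ) :
    ContinuousOn (sinSol q k) (Icc 0 ℓ) :=
  continuousOn_volterraSol hq (continuous_sinKernel k).continuousOn

lemma cosSol_expand (hq : IntervalIntegrable q volume 0 ℓ) (k : ℂ) {x : ℝ} (hx : x ∈ Icc 0 ℓ) :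
    cosSol q k x = Complex.cos (k * x) + (sinKernel k x * cosMoment q k (cosSol q k) x -
      Complex.cos (k * x) * sinMoment q k (cosSol q k) x) := by
  unfold cosMoment sinMoment
  rw [← volterraOp_expand hq (continuousOn_cosSol hq k) hx]
  exact volterraSol_eq hq
    (by fun_prop : Continuous fun x : ℝ => Complex.cos (k * x)).continuousOn hx

lemma sinSol_expand (hq : IntervalIntegrable q volume 0 ℓ) (k : ℂ) {x : ℝ} (hx : x ∈ Icc 0 ℓ) :
    sinSol q k x = sinKernel k x + (sinKernel k x * cosMoment q k (sinSol q k) x -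
      Complex.cos (k * x) * sinMoment q k (sinSol q k) x) := by
  unfold cosMoment sinMoment
  rw [← volterraOp_expand hq (continuousOn_sinSol hq k) hx]
  exact volterraSol_eq hq (continuous_sinKernel k).continuousOn hx

/-- The Wronskian of the two fundamental solutions is one. -/
theorem wronskian_eq_one (hℓ : 0 < ℓ) (hq : IntervalIntegrable q volume 0 ℓ) (k : ℂ) :
    cosSol q k ℓ * derivWithin (sinSol q k) (Icc 0 ℓ) ℓ -
      derivWithin (cosSol q k) (Icc 0 ℓ) ℓ * sinSol q k ℓ = 1 := by
  have hc := continuousOn_cosSol hq k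
  have hs := continuousOn_sinSol hq k
  have hmem : ℓ ∈ Icc 0 ℓ := ⟨hℓ.le, le_rfl⟩
  have hAc := intervalIntegrable_cosMoment (k := k) hℓ.le hq hc
  have hBc := intervalIntegrable_sinMoment (k := k) hℓ.le hq hc
  have hAs := intervalIntegrable_cosMoment (k := k) hℓ.le hq hs
  have hBs := intervalIntegrable_sinMoment (k := k) hℓ.le hq hs
  have hone : AbsolutelyContinuousOnInterval (fun _ : ℝ => (1 : ℂ)) 0 ℓ :=
    contDiffOn_const.absolutelyContinuousOnInterval
  -- Variation of constants: this is the determinant of the coefficients of c and s in the basis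
  -- cos(kx), sin(kx)/k. The Wronskian is this determinant times cos² + sin² = 1. Its derivative is
  -- q(cs - cs) = 0 almost everywhere, and its value at 0 is 1.
  have hac : AbsolutelyContinuousOnInterval (fun x =>
      (1 - sinMoment q k (cosSol q k) x) * (1 + cosMoment q k (sinSol q k) x) +
        cosMoment q k (cosSol q k) x * sinMoment q k (sinSol q k) x) 0 ℓ :=
    ((hone.sub (absolutelyContinuousOnInterval_primitive hBc)).smul
      (hone.add (absolutelyContinuousOnInterval_primitive hAs))).add
      ((absolutelyContinuousOnInterval_primitive hAc).smul
        (absolutelyContinuousOnInterval_primitive hBs))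
  obtain ⟨c, hconst⟩ := hac.const_of_ae_hasDerivAt_zero (by
    filter_upwards [hAc.ae_hasDerivAt_integral, hBc.ae_hasDerivAt_integral,
      hAs.ae_hasDerivAt_integral, hBs.ae_hasDerivAt_integral] with t h1 h2 h3 h4 ht
    have d1 : HasDerivAt (cosMoment q k (cosSol q k)) _ t := h1 ht 0 left_mem_uIcc
    have d2 : HasDerivAt (sinMoment q k (cosSol q k)) _ t := h2 ht 0 left_mem_uIcc
    have d3 : HasDerivAt (cosMoment q k (sinSol q k)) _ t := h3 ht 0 left_mem_uIcc
    have d4 : HasDerivAt (sinMoment q k (sinSol q k)) _ t := h4 ht 0 left_mem_uIcc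
    rw [uIcc_of_le hℓ.le] at ht
    have ec := cosSol_expand hq k ht
    have es := sinSol_expand hq k ht
    refine (((d2.const_sub 1).fun_mul (d3.const_add 1)).fun_add (d1.fun_mul d4)).congr_deriv ?_
    linear_combination (-(q t : ℂ) * sinSol q k t) * ec + ((q t : ℂ) * cosSol q k t) * es)
  rw [uIcc_of_le hℓ.le] at hconst
  have h1 := (hconst ℓ hmem).trans (hconst 0 ⟨le_rfl, hℓ.le⟩).symm
  simp only [cosMoment_zero, sinMoment_zero] at h1
  have hcs := cos_sq_add_sinKernel_sq k ℓ
  rw [derivWithin_cosSol hℓ hq, derivWithin_sinSol hℓ hq, volterraDeriv_expand hq hc hmem,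
    volterraDeriv_expand hq hs hmem]
  have ec := cosSol_expand hq k hmem
  have es := sinSol_expand hq k hmem
  generalize cosMoment q k (cosSol q k) ℓ = a at *
  generalize sinMoment q k (cosSol q k) ℓ = b at *
  generalize cosMoment q k (sinSol q k) ℓ = a' at *
  generalize sinMoment q k (sinSol q k) ℓ = b' at *
  rw [ec, es]
  linear_combination hcs * ((1 - b) * (1 + a') + a * b') + h1

end Derivative

/-! ### Entire dependence on the spectral parameter. -/

section Holomorphy

open Filter Topology

/-- A family of functions on `[0, ℓ]` that are continuous in the variable, entire in the parameter
and locally bounded in the parameter. -/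
structure EntireFamily (ℓ : ℝ) (F : ℂ → ℝ → ℂ) : Prop where
  continuousOn : ∀ k, ContinuousOn (F k) (Icc 0 ℓ)
  differentiable : ∀ x ∈ Icc 0 ℓ, Differentiable ℂ fun k => F k x
  bounded : ∀ R : ℝ, ∃ B : ℝ, ∀ k : ℂ, ‖k‖ ≤ R → ∀ x ∈ Icc 0 ℓ, ‖F k x‖ ≤ B

variable {ℓ : ℝ} {q : ℝ → ℝ} {F G : ℂ → ℝ → ℂ}

lemma EntireFamily.mul (hF : EntireFamily ℓ F) (hG : EntireFamily ℓ G) :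
    EntireFamily ℓ fun k x => F k x * G k x where
  continuousOn k := (hF.continuousOn k).mul (hG.continuousOn k)
  differentiable x hx := (hF.differentiable x hx).mul (hG.differentiable x hx)
  bounded R := by
    obtain ⟨A, hA⟩ := hF.bounded R
    obtain ⟨B, hB⟩ := hG.bounded R
    refine ⟨A * B, fun k hk x hx => ?_⟩
    rw [norm_mul]
    exact mul_le_mul (hA k hk x hx) (hB k hk x hx) (norm_nonneg _)
      ((norm_nonneg _).trans (hA k hk x hx))

lemma EntireFamily.mono (hF : EntireFamily ℓ F) {x : ℝ} (hx : x ≤ ℓ) : EntireFamily x F where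
  continuousOn k := (hF.continuousOn k).mono (Icc_subset_Icc_right hx)
  differentiable t ht := hF.differentiable t ⟨ht.1, ht.2.trans hx⟩
  bounded R := by
    obtain ⟨A, hA⟩ := hF.bounded R
    exact ⟨A, fun k hk t ht => hA k hk t ⟨ht.1, ht.2.trans hx⟩⟩

lemma EntireFamily.reflect (hF : EntireFamily ℓ F) :
    EntireFamily ℓ fun k t => F k (ℓ - t) where
  continuousOn k := (hF.continuousOn k).comp (by fun_prop) fun t ht =>
    ⟨by linarith [ht.2], by linarith [ht.1]⟩
  differentiable t ht := hF.differentiable _ ⟨by linarith [ht.2], by linarith [ht.1]⟩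
  bounded R := by
    obtain ⟨A, hA⟩ := hF.bounded R
    exact ⟨A, fun k hk t ht => hA k hk _ ⟨by linarith [ht.2], by linarith [ht.1]⟩⟩

/-- Differentiation under the integral sign: Cauchy's estimate converts the local bound on `F` into
one on its derivative in k, so a multiple of |q| dominates. -/
lemma EntireFamily.differentiable_integral (hℓ : 0 ≤ ℓ) (hq : IntervalIntegrable q volume 0 ℓ)
    (hF : EntireFamily ℓ F) :
    Differentiable ℂ fun k => ∫ t in (0 : ℝ)..ℓ, (q t : ℂ) * F k t := by
  intro k₀
  -- One unit for the ball around `k₀`, one for the radius of the Cauchy circle.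
  obtain ⟨B, hB⟩ := hF.bounded (‖k₀‖ + 2)
  have hint : ∀ k, IntervalIntegrable (fun t => (q t : ℂ) * F k t) volume 0 ℓ := fun k =>
    intervalIntegrable_mul hq hℓ (hF.continuousOn k)
  have hmem : ∀ t ∈ uIoc 0 ℓ, t ∈ Icc 0 ℓ := fun t ht => by
    rw [uIoc_of_le hℓ] at ht
    exact ⟨ht.1.le, ht.2⟩
  have hdiff : ∀ t ∈ uIoc 0 ℓ, ∀ k, HasDerivAt (fun k => (q t : ℂ) * F k t)
      ((q t : ℂ) * deriv (fun k => F k t) k) k := fun t ht k =>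
    ((hF.differentiable t (hmem t ht)) k).hasDerivAt.const_mul _
  refine (intervalIntegral.hasDerivAt_integral_of_dominated_loc_of_deriv_le
    (F' := fun k t => (q t : ℂ) * deriv (fun k => F k t) k) (bound := fun t => |q t| * B)
    (Metric.ball_mem_nhds k₀ one_pos) (Eventually.of_forall fun k =>
      (hint k).aestronglyMeasurable_restrict_uIoc) (hint k₀) ?_ ?_ (hq.abs.mul_const B)
    (Eventually.of_forall fun t ht k _ => hdiff t ht k)).2.differentiableAt
  · refine aestronglyMeasurable_of_tendsto_ae (𝓝[≠] (0 : ℂ))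
      (f := fun h t => h⁻¹ • ((q t : ℂ) * F (k₀ + h) t - (q t : ℂ) * F k₀ t)) (fun h => ?_) ?_
    · exact AEStronglyMeasurable.const_smul ((hint (k₀ + h)).aestronglyMeasurable_restrict_uIoc.sub
        (hint k₀).aestronglyMeasurable_restrict_uIoc) h⁻¹
    · refine (ae_restrict_iff' measurableSet_uIoc).2 (Eventually.of_forall fun t ht => ?_)
      exact (hdiff t ht k₀).tendsto_slope_zero
  · refine Eventually.of_forall fun t ht k hk => ?_
    rw [norm_mul, Complex.norm_real, Real.norm_eq_abs]
    gcongr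
    have hk' : ‖k‖ ≤ ‖k₀‖ + 1 := by
      have := norm_sub_norm_le k k₀
      rw [Metric.mem_ball, dist_eq_norm] at hk
      linarith
    have := Complex.norm_deriv_le_of_forall_mem_sphere_norm_le (c := k) one_pos
      (hF.differentiable t (hmem t ht)).diffContOnCl (C := B) (fun z hz => hB z ?_ t (hmem t ht))
    · simpa using this
    · have h1 := norm_sub_norm_le z k
      rw [Metric.mem_sphere, dist_eq_norm] at hz
      linarith

lemma norm_cos_le_exp (z : ℂ) : ‖Complex.cos z‖ ≤ Real.exp |z.im| := by
  rw [Complex.cos, norm_div, Complex.norm_ofNat, div_le_iff₀ two_pos]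
  refine (norm_add_le _ _).trans ?_
  rw [Complex.norm_exp, Complex.norm_exp]
  have h1 : Real.exp (z * Complex.I).re ≤ Real.exp |z.im| :=
    Real.exp_le_exp.2 (by simpa using neg_le_abs z.im)
  have h2 : Real.exp (-z * Complex.I).re ≤ Real.exp |z.im| :=
    Real.exp_le_exp.2 (by simpa using le_abs_self z.im)
  linarith

lemma norm_sin_le_exp (z : ℂ) : ‖Complex.sin z‖ ≤ Real.exp |z.im| := by
  rw [Complex.sin, norm_div, Complex.norm_ofNat, div_le_iff₀ two_pos, norm_mul, Complex.norm_I,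
    mul_one]
  refine (norm_sub_le _ _).trans ?_
  rw [Complex.norm_exp, Complex.norm_exp]
  have h1 : Real.exp (z * Complex.I).re ≤ Real.exp |z.im| :=
    Real.exp_le_exp.2 (by simpa using neg_le_abs z.im)
  have h2 : Real.exp (-z * Complex.I).re ≤ Real.exp |z.im| :=
    Real.exp_le_exp.2 (by simpa using le_abs_self z.im)
  linarith

lemma entireFamily_cos (ℓ : ℝ) : EntireFamily ℓ fun k x => Complex.cos (k * x) where
  continuousOn k := by fun_prop
  differentiable x _ := by fun_prop
  bounded R := by
    refine ⟨Real.exp (R * ℓ), fun k hk x hx => (norm_cos_le_exp _).trans (Real.exp_le_exp.2 ?_)⟩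
    rw [Complex.im_mul_ofReal, abs_mul, abs_of_nonneg hx.1]
    exact mul_le_mul ((Complex.abs_im_le_norm k).trans hk) hx.2 hx.1 ((norm_nonneg k).trans hk)

/-- The singularity at k = 0 is removable: the kernel is the difference quotient of sin(kx) at 0,
extended by the derivative x. -/
lemma differentiable_sinKernel (x : ℝ) : Differentiable ℂ fun k => sinKernel k x := by
  have e : (fun k => sinKernel k x) = dslope (fun k : ℂ => Complex.sin (k * x)) 0 := by
    ext k
    unfold sinKernel
    split_ifs with h
    · have h1 : HasDerivAt (fun w : ℂ => w * x) x 0 := by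
        simpa using (hasDerivAt_id (0 : ℂ)).mul_const (x : ℂ)
      subst h
      rw [dslope_same, h1.csin.deriv]
      simp
    · rw [dslope_of_ne _ h, slope_def_field]
      simp
  rw [e]
  exact differentiable_dslope (by fun_prop) 0

lemma entireFamily_sinKernel (ℓ : ℝ) : EntireFamily ℓ sinKernel where
  continuousOn k := (continuous_sinKernel k).continuousOn
  differentiable x _ := differentiable_sinKernel x
  bounded R := by
    obtain ⟨B, hB⟩ := (entireFamily_cos ℓ).bounded R
    refine ⟨B * ℓ, fun k hk x hx => ?_⟩
    have h0 : (0 : ℝ) ∈ Icc 0 ℓ := ⟨le_rfl, hx.1.trans hx.2⟩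
    -- The mean value inequality from 0 gives a bound uniform near k = 0, where dividing by k would
    -- not.
    have h := Convex.norm_image_sub_le_of_norm_hasDerivWithin_le
      (fun t _ => (hasDerivAt_sinKernel k t).hasDerivWithinAt) (fun t ht => hB k hk t ht)
      (convex_Icc 0 ℓ) h0 hx
    have e0 : sinKernel k 0 = 0 := by simp [sinKernel]
    rw [e0, sub_zero, sub_zero, Real.norm_eq_abs, abs_of_nonneg hx.1] at h
    exact h.trans (mul_le_mul_of_nonneg_left hx.2 ((norm_nonneg _).trans (hB k hk 0 h0)))

lemma EntireFamily.exists_iterate_bound (hq : IntervalIntegrable q volume 0 ℓ)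
    (hF : EntireFamily ℓ F) (R : ℝ) :
    ∃ u : ℕ → ℝ, Summable u ∧ ∀ n, ∀ k : ℂ, ‖k‖ ≤ R → ∀ x ∈ Icc 0 ℓ,
      ‖((volterraOp q k)^[n] (F k)) x‖ ≤ u n := by
  obtain ⟨M, hM⟩ := (entireFamily_sinKernel ℓ).bounded R
  obtain ⟨B, hB⟩ := hF.bounded R
  refine ⟨fun n => B * ((M * ∫ t in (0 : ℝ)..ℓ, |q t|) ^ n / n.factorial),
    (Real.summable_pow_div_factorial _).mul_left _, fun n k hk x hx => ?_⟩
  refine (iterate_bound hq (hM k hk) (hB k hk) n x hx).trans ?_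
  rw [mul_div_assoc]
  have hM0 : 0 ≤ M := (norm_nonneg _).trans (hM k hk x hx)
  have hB0 : 0 ≤ B := (norm_nonneg _).trans (hB k hk x hx)
  have h0 : 0 ≤ ∫ t in (0 : ℝ)..x, |q t| :=
    intervalIntegral.integral_nonneg hx.1 (fun t _ => abs_nonneg _)
  have h1 : ∫ t in (0 : ℝ)..x, |q t| ≤ ∫ t in (0 : ℝ)..ℓ, |q t| :=
    intervalIntegral.integral_mono_interval le_rfl hx.1 hx.2
      (Eventually.of_forall fun t => abs_nonneg _) hq.abs
  dsimp only
  gcongr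

lemma EntireFamily.volterraOp (hq : IntervalIntegrable q volume 0 ℓ) (hF : EntireFamily ℓ F) :
    EntireFamily ℓ fun k => volterraOp q k (F k) where
  continuousOn k := continuousOn_volterraOp hq (hF.continuousOn k)
  bounded R := by
    obtain ⟨u, -, hu⟩ := hF.exists_iterate_bound hq R
    -- The operator is its own first iterate.
    exact ⟨u 1, hu 1⟩
  differentiable x hx := by
    have hqx : IntervalIntegrable q volume 0 x := hq.mono_set (by
      rw [uIcc_of_le hx.1, uIcc_of_le (hx.1.trans hx.2)]
      exact Icc_subset_Icc_right hx.2)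
    have h := ((entireFamily_sinKernel x).reflect.mul (hF.mono hx.2)).differentiable_integral
      hx.1 hqx
    convert h using 2 with k
    unfold QGraph.volterraOp
    congr 1
    ext t
    ring

lemma EntireFamily.iterate (hq : IntervalIntegrable q volume 0 ℓ) (hF : EntireFamily ℓ F) (n : ℕ) :
    EntireFamily ℓ fun k => (QGraph.volterraOp q k)^[n] (F k) := by
  induction n with
  | zero => simpa using hF
  | succ n ih => simpa only [Function.iterate_succ_apply'] using ih.volterraOp hq

/-- The factorial bound on the iterates is uniform for ‖k‖ ≤ R, so Weierstrass's theorem applies on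
every disc. -/
lemma EntireFamily.volterraSol (hq : IntervalIntegrable q volume 0 ℓ) (hF : EntireFamily ℓ F) :
    EntireFamily ℓ fun k => volterraSol q k (F k) where
  continuousOn k := continuousOn_volterraSol hq (hF.continuousOn k)
  differentiable x hx k := by
    obtain ⟨u, hu, hb⟩ := hF.exists_iterate_bound hq (‖k‖ + 1)
    have h := Complex.differentiableOn_tsum_of_summable_norm (U := Metric.ball 0 (‖k‖ + 1)) hu
      (fun n => ((hF.iterate hq n).differentiable x hx).differentiableOn) Metric.isOpen_ball
      (fun n w hw => hb n w (by simpa using (mem_ball_zero_iff.1 hw).le) x hx)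
    exact h.differentiableAt (Metric.isOpen_ball.mem_nhds (by simp))
  bounded R := by
    obtain ⟨u, hu, hb⟩ := hF.exists_iterate_bound hq R
    exact ⟨∑' n, u n, fun k hk x hx => tsum_of_norm_bounded hu.hasSum fun n => hb n k hk x hx⟩

lemma EntireFamily.differentiable_volterraDeriv (hℓ : 0 ≤ ℓ) (hq : IntervalIntegrable q volume 0 ℓ)
    (hF : EntireFamily ℓ F) : Differentiable ℂ fun k => volterraDeriv q k (F k) ℓ := by
  have h := ((entireFamily_cos ℓ).reflect.mul hF).differentiable_integral hℓ hq
  convert h using 2 with k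
  unfold volterraDeriv
  congr 1
  ext t
  ring

lemma entireFamily_cosSol (hq : IntervalIntegrable q volume 0 ℓ) : EntireFamily ℓ (cosSol q) :=
  (entireFamily_cos ℓ).volterraSol hq

lemma entireFamily_sinSol (hq : IntervalIntegrable q volume 0 ℓ) : EntireFamily ℓ (sinSol q) :=
  (entireFamily_sinKernel ℓ).volterraSol hq

lemma differentiable_derivWithin_cosSol (hℓ : 0 < ℓ) (hq : IntervalIntegrable q volume 0 ℓ) :
    Differentiable ℂ fun k => derivWithin (cosSol q k) (Icc 0 ℓ) ℓ := by
  simp_rw [derivWithin_cosSol hℓ hq]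
  have h1 := differentiable_sinKernel ℓ
  have h2 := (entireFamily_cosSol hq).differentiable_volterraDeriv hℓ.le hq
  fun_prop

lemma differentiable_derivWithin_sinSol (hℓ : 0 < ℓ) (hq : IntervalIntegrable q volume 0 ℓ) :
    Differentiable ℂ fun k => derivWithin (sinSol q k) (Icc 0 ℓ) ℓ := by
  simp_rw [derivWithin_sinSol hℓ hq]
  have h2 := (entireFamily_sinSol hq).differentiable_volterraDeriv hℓ.le hq
  fun_prop

theorem differentiable_secular {d : ℕ} {ℓ : Fin d → ℝ} (hℓ : ∀ i, 0 < ℓ i) {q : Fin d → ℝ → ℝ}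
    (hq : ∀ i, IntervalIntegrable (q i) volume 0 (ℓ i))
    (U : Matrix (Fin d × Fin 2) (Fin d × Fin 2) ℂ) : Differentiable ℂ (secular ℓ q U) := by
  have hm : ∀ i, ℓ i ∈ Icc 0 (ℓ i) := fun i => ⟨(hℓ i).le, le_rfl⟩
  have h1 : ∀ p r, Differentiable ℂ fun k => M₁ ℓ q k p r := by
    rintro ⟨i, a⟩ ⟨j, b⟩
    have hc := (entireFamily_cosSol (hq i)).differentiable _ (hm i)
    have hs := (entireFamily_sinSol (hq i)).differentiable _ (hm i)
    by_cases hij : i = j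
    · subst hij
      fin_cases a <;> fin_cases b <;> simp [M₁, hc, hs]
    · simp [M₁, hij]
  have h2 : ∀ p r, Differentiable ℂ fun k => M₂ ℓ q k p r := by
    rintro ⟨i, a⟩ ⟨j, b⟩
    have hc := differentiable_derivWithin_cosSol (hℓ i) (hq i)
    have hs := differentiable_derivWithin_sinSol (hℓ i) (hq i)
    by_cases hij : i = j
    · subst hij
      fin_cases a <;> fin_cases b <;> simp [M₂, hc, hs]
    · simp [M₂, hij]
  unfold secular
  simp only [Matrix.det_apply, Matrix.add_apply, Matrix.mul_apply]
  fun_prop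

end Holomorphy

/-! ### Growth of the fundamental solutions for large k. -/

section Asymptotics

open Filter Topology Asymptotics Bornology

variable {ℓ : ℝ} {q : ℝ → ℝ} {k : ℂ}

/-- The weights e^{τ(x-t)} and e^{τt} multiply to e^{τx} for every t, so the integral operator
preserves the exponential rate. -/
lemma norm_integral_mul_le (hq : IntervalIntegrable q volume 0 ℓ) {x : ℝ} (hx : x ∈ Icc 0 ℓ)
    {κ y : ℝ → ℂ} {τ a m : ℝ} (ha : 0 ≤ a) (hm : 0 ≤ m)
    (hκ : ∀ t ∈ Icc 0 x, ‖κ t‖ ≤ a * Real.exp (τ * (x - t)))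
    (hy : ∀ t ∈ Icc 0 x, ‖y t‖ ≤ m * Real.exp (τ * t)) :
    ‖∫ t in (0 : ℝ)..x, κ t * (q t : ℂ) * y t‖ ≤
      a * m * Real.exp (τ * x) * ∫ t in (0 : ℝ)..ℓ, |q t| := by
  have hqx : IntervalIntegrable (fun t => |q t|) volume 0 x := by
    refine (hq.mono_set ?_).abs
    rw [uIcc_of_le hx.1, uIcc_of_le (hx.1.trans hx.2)]
    exact Icc_subset_Icc_right hx.2
  have h := intervalIntegral.norm_integral_le_of_norm_le (μ := volume) hx.1
    (f := fun t => κ t * (q t : ℂ) * y t) (g := fun t => a * m * Real.exp (τ * x) * |q t|)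
    (Eventually.of_forall fun t ht => ?_) (hqx.const_mul _)
  · refine h.trans ?_
    rw [intervalIntegral.integral_const_mul]
    gcongr
    exact intervalIntegral.integral_mono_interval le_rfl hx.1 hx.2
      (Eventually.of_forall fun t => abs_nonneg _) hq.abs
  · have ht' : t ∈ Icc 0 x := ⟨ht.1.le, ht.2⟩
    rw [norm_mul, norm_mul, Complex.norm_real, Real.norm_eq_abs]
    calc ‖κ t‖ * |q t| * ‖y t‖
        ≤ a * Real.exp (τ * (x - t)) * |q t| * (m * Real.exp (τ * t)) := by
          gcongr
          · exact hκ t ht'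
          · exact hy t ht'
      _ = a * m * (Real.exp (τ * (x - t)) * Real.exp (τ * t)) * |q t| := by ring
      _ = a * m * Real.exp (τ * x) * |q t| := by
          rw [← Real.exp_add]
          ring_nf

lemma norm_cos_mul_le (k : ℂ) {x : ℝ} (hx : 0 ≤ x) :
    ‖Complex.cos (k * x)‖ ≤ Real.exp (|k.im| * x) := by
  simpa [abs_mul, abs_of_nonneg hx] using norm_cos_le_exp (k * x)

lemma norm_sinKernel_le (hk : k ≠ 0) {x : ℝ} (hx : 0 ≤ x) :
    ‖sinKernel k x‖ ≤ ‖k‖⁻¹ * Real.exp (|k.im| * x) := by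
  rw [sinKernel, if_neg hk, norm_div, div_eq_inv_mul]
  gcongr
  simpa [abs_mul, abs_of_nonneg hx] using norm_sin_le_exp (k * x)

/-- For large `k` the solution of the Volterra equation is at most twice its inhomogeneous term. -/
lemma norm_volterraSol_le (hq : IntervalIntegrable q volume 0 ℓ) (hk : k ≠ 0)
    (hQ : 2 * (∫ t in (0 : ℝ)..ℓ, |q t|) ≤ ‖k‖) {f : ℝ → ℂ} (hf : ContinuousOn f (Icc 0 ℓ)) {F : ℝ}
    (hF : ∀ x ∈ Icc 0 ℓ, ‖f x‖ ≤ F * Real.exp (|k.im| * x)) {x : ℝ} (hx : x ∈ Icc 0 ℓ) :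
    ‖volterraSol q k f x‖ ≤ 2 * F * Real.exp (|k.im| * x) := by
  set y := volterraSol q k f with hydef
  have hyc : ContinuousOn y (Icc 0 ℓ) := continuousOn_volterraSol hq hf
  -- Let m be the maximum of |y| e^{-τx}. The equation at the maximum point gives m ≤ F + m/2, since
  -- the kernel contributes 1/|k| and ∫|q| ≤ |k|/2.
  obtain ⟨x₀, hx₀, hmax⟩ := isCompact_Icc.exists_isMaxOn ⟨x, hx⟩
    (f := fun x => ‖y x‖ * Real.exp (-(|k.im| * x)))
    (hyc.norm.mul (by fun_prop))
  set m := ‖y x₀‖ * Real.exp (-(|k.im| * x₀)) with hm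
  have hm0 : 0 ≤ m := by positivity
  have hle : ∀ t ∈ Icc 0 ℓ, ‖y t‖ ≤ m * Real.exp (|k.im| * t) := fun t ht => by
    have : ‖y t‖ * Real.exp (-(|k.im| * t)) ≤ m := hmax ht
    rwa [Real.exp_neg, ← div_eq_mul_inv, div_le_iff₀ (Real.exp_pos _)] at this
  have hk' : 0 < ‖k‖ := norm_pos_iff.2 hk
  have hint := norm_integral_mul_le hq hx₀ (κ := fun t => sinKernel k (x₀ - t)) (y := y)
    (inv_nonneg.2 hk'.le) hm0
    (fun t ht => norm_sinKernel_le hk (by linarith [ht.2]))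
    (fun t ht => hle t ⟨ht.1, ht.2.trans hx₀.2⟩)
  have hy0 : ‖y x₀‖ ≤ (F + m / 2) * Real.exp (|k.im| * x₀) := by
    rw [hydef, volterraSol_eq hq hf hx₀]
    refine (norm_add_le _ _).trans ?_
    rw [add_mul]
    refine add_le_add (hF _ hx₀) (hint.trans ?_)
    have : ‖k‖⁻¹ * (∫ t in (0 : ℝ)..ℓ, |q t|) ≤ 1 / 2 := by
      rw [inv_mul_le_iff₀ hk']
      linarith
    calc _ = m * Real.exp (|k.im| * x₀) * (‖k‖⁻¹ * (∫ t in (0 : ℝ)..ℓ, |q t|)) := by ring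
      _ ≤ m * Real.exp (|k.im| * x₀) * (1 / 2) := by gcongr
      _ = _ := by ring
  have hmle : m ≤ F + m / 2 := by
    have h1 : Real.exp (|k.im| * x₀) * Real.exp (-(|k.im| * x₀)) = 1 := by
      rw [← Real.exp_add, add_neg_cancel, Real.exp_zero]
    calc m ≤ (F + m / 2) * Real.exp (|k.im| * x₀) * Real.exp (-(|k.im| * x₀)) := by
          rw [hm]
          gcongr
      _ = F + m / 2 := by rw [mul_assoc, h1, mul_one]
  refine (hle x hx).trans ?_
  gcongr
  linarith

lemma norm_volterraDeriv_le (hℓ : 0 ≤ ℓ) (hq : IntervalIntegrable q volume 0 ℓ) {y : ℝ → ℂ} {m : ℝ}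
    (hm : 0 ≤ m) (hy : ∀ x ∈ Icc 0 ℓ, ‖y x‖ ≤ m * Real.exp (|k.im| * x)) :
    ‖volterraDeriv q k y ℓ‖ ≤
      (m * ∫ t in (0 : ℝ)..ℓ, |q t|) * Real.exp (|k.im| * ℓ) := by
  refine (norm_integral_mul_le hq ⟨hℓ, le_rfl⟩ (κ := fun t => Complex.cos (k * (ℓ - t : ℝ)))
    zero_le_one hm (fun t ht => ?_) hy).trans (le_of_eq (by ring))
  rw [one_mul]
  exact norm_cos_mul_le k (by linarith [ht.2])

lemma eventually_large (Q : ℝ) : ∀ᶠ k : ℂ in cobounded ℂ, k ≠ 0 ∧ 1 ≤ ‖k‖ ∧ 2 * Q ≤ ‖k‖ := by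
  filter_upwards [tendsto_norm_cobounded_atTop.eventually_ge_atTop 1,
    tendsto_norm_cobounded_atTop.eventually_ge_atTop (2 * Q)] with k h1 h2
  exact ⟨norm_pos_iff.1 (by linarith), h1, h2⟩

lemma eventually_norm_cosSol_le (hq : IntervalIntegrable q volume 0 ℓ) :
    ∀ᶠ k : ℂ in cobounded ℂ, ∀ x ∈ Icc 0 ℓ, ‖cosSol q k x‖ ≤ 2 * Real.exp (|k.im| * x) := by
  filter_upwards [eventually_large (∫ t in (0 : ℝ)..ℓ, |q t|)] with k hk x hx
  simpa [cosSol] using norm_volterraSol_le hq hk.1 hk.2.2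
    (by fun_prop : Continuous fun x : ℝ => Complex.cos (k * x)).continuousOn
    (F := 1) (fun x hx => by simpa using norm_cos_mul_le k hx.1) hx

lemma eventually_norm_sinSol_le (hq : IntervalIntegrable q volume 0 ℓ) :
    ∀ᶠ k : ℂ in cobounded ℂ, ∀ x ∈ Icc 0 ℓ, ‖sinSol q k x‖ ≤ 2 * Real.exp (|k.im| * x) := by
  filter_upwards [eventually_large (∫ t in (0 : ℝ)..ℓ, |q t|)] with k hk x hx
  have h := norm_volterraSol_le hq hk.1 hk.2.2 (continuous_sinKernel k).continuousOn
    (F := 1) (fun x hx => (norm_sinKernel_le hk.1 hx.1).trans (by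
      gcongr
      exact inv_le_one_of_one_le₀ hk.2.1)) hx
  simpa [sinSol] using h

lemma isBigO_cosSol (hℓ : 0 < ℓ) (hq : IntervalIntegrable q volume 0 ℓ) :
    (fun k => cosSol q k ℓ) =O[cobounded ℂ] fun k => Real.exp (|k.im| * ℓ) := by
  refine IsBigO.of_bound 2 ?_
  filter_upwards [eventually_norm_cosSol_le hq] with k hk
  simpa using hk ℓ ⟨hℓ.le, le_rfl⟩

lemma isBigO_derivWithin_sinSol (hℓ : 0 < ℓ) (hq : IntervalIntegrable q volume 0 ℓ) :
    (fun k => derivWithin (sinSol q k) (Icc 0 ℓ) ℓ) =O[cobounded ℂ]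
      fun k => Real.exp (|k.im| * ℓ) := by
  refine IsBigO.of_bound (1 + 2 * ∫ t in (0 : ℝ)..ℓ, |q t|) ?_
  filter_upwards [eventually_norm_sinSol_le hq] with k hk
  rw [derivWithin_sinSol hℓ hq, Real.norm_eq_abs, Real.abs_exp, add_mul, one_mul]
  exact (norm_add_le _ _).trans
    (add_le_add (norm_cos_mul_le k hℓ.le) (norm_volterraDeriv_le hℓ.le hq zero_le_two hk))

/-- Differentiating cos(kx) produces the extra factor k, while the integral term stays at the scale
of c itself. Hence the leading term of the secular function. -/
lemma isBigO_derivWithin_cosSol_sub (hℓ : 0 < ℓ) (hq : IntervalIntegrable q volume 0 ℓ) :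
    (fun k => derivWithin (cosSol q k) (Icc 0 ℓ) ℓ - -k * Complex.sin (k * ℓ)) =O[cobounded ℂ]
      fun k => Real.exp (|k.im| * ℓ) := by
  refine IsBigO.of_bound (2 * ∫ t in (0 : ℝ)..ℓ, |q t|) ?_
  filter_upwards [eventually_norm_cosSol_le hq, eventually_large 0] with k hk hk'
  rw [derivWithin_cosSol hℓ hq, Real.norm_eq_abs, Real.abs_exp]
  have e : -(k ^ 2 * sinKernel k ℓ) = -k * Complex.sin (k * ℓ) := by
    rw [sinKernel, if_neg hk'.1]
    have := hk'.1
    field_simp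
  rw [e, add_sub_cancel_left]
  exact norm_volterraDeriv_le hℓ.le hq zero_le_two hk

/-! ### Lower bounds for the sine on admissible contours. -/

/-- The points on those square contours whose half side stays `ε / ℓᵢ`-away from all `n π / ℓᵢ`. -/
def admissibleContours {d : ℕ} (ℓ : Fin d → ℝ) (ε : ℝ) : Set ℂ :=
  ⋃ N ∈ (⋃ (i : Fin d) (n : ℕ),
    Ioo (n * Real.pi / ℓ i - ε / ℓ i) (n * Real.pi / ℓ i + ε / ℓ i))ᶜ, squareContour N

/-- Jordan's inequality, applied to the distance from a to the nearest multiple of π. -/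
lemma abs_sin_ge {a ε : ℝ} (ha : 0 ≤ a)
    (h : ∀ n : ℕ, a ∉ Ioo (n * Real.pi - ε) (n * Real.pi + ε)) :
    2 / Real.pi * ε ≤ |Real.sin a| := by
  have hπ := Real.pi_pos
  -- Only natural multiples of π are excluded, so the nearest integer must be nonnegative.
  have hn : 0 ≤ round (a / Real.pi) := by
    rw [round_eq]
    exact Int.floor_nonneg.2 (by positivity)
  obtain ⟨n, hn⟩ := Int.eq_ofNat_of_zero_le hn
  have hr := abs_sub_round (a / Real.pi)
  rw [hn, Int.cast_natCast] at hr
  have hr' : |a - n * Real.pi| ≤ Real.pi / 2 := by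
    have e : a - n * Real.pi = (a / Real.pi - n) * Real.pi := by field_simp
    rw [e, abs_mul, abs_of_pos hπ]
    nlinarith
  have h1 := Real.mul_abs_le_abs_sin hr'
  have h2 : |Real.sin (a - n * Real.pi)| = |Real.sin a| := by
    rw [Real.sin_sub_nat_mul_pi]
    simp [abs_mul]
  rw [h2] at h1
  refine le_trans ?_ h1
  gcongr
  by_contra hlt
  push Not at hlt
  rw [abs_lt] at hlt
  exact h n ⟨by linarith, by linarith⟩

/-- Uses Re sin z = sin(Re z) cosh(Im z). It serves the vertical sides of the contour. -/
lemma norm_sin_ge_of_abs_re (z : ℂ) : |Real.sin z.re| / 2 * Real.exp |z.im| ≤ ‖Complex.sin z‖ := by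
  have hre : (Complex.sin z).re = Real.sin z.re * Real.cosh z.im := by
    rw [Complex.sin_eq]
    simp [← Complex.ofReal_sin, ← Complex.ofReal_cosh, ← Complex.ofReal_cos, ← Complex.ofReal_sinh]
  refine le_trans ?_ (Complex.abs_re_le_norm _)
  rw [hre, abs_mul, abs_of_pos (Real.cosh_pos _), ← Real.cosh_abs, Real.cosh_eq]
  have := Real.exp_pos (-|z.im|)
  nlinarith [abs_nonneg (Real.sin z.re)]

/-- Uses |sin z|² = sin²(Re z) + sinh²(Im z). It serves the horizontal sides, where the real part is
arbitrary. -/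
lemma norm_sin_ge_of_abs_im (z : ℂ) (hz : 1 ≤ |z.im|) :
    1 / 4 * Real.exp |z.im| ≤ ‖Complex.sin z‖ := by
  have hsq : Real.sinh |z.im| ^ 2 ≤ ‖Complex.sin z‖ ^ 2 := by
    have e : Complex.sin z = ((Real.sin z.re * Real.cosh z.im : ℝ) : ℂ) +
        ((Real.cos z.re * Real.sinh z.im : ℝ) : ℂ) * Complex.I := by
      rw [Complex.sin_eq]
      push_cast
      ring
    rw [Complex.sq_norm, e, Complex.normSq_add_mul_I, ← Real.abs_sinh, sq_abs]
    have h1 := Real.sin_sq_add_cos_sq z.re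
    have h2 := Real.cosh_sq z.im
    nlinarith [sq_nonneg (Real.sin z.re)]
  refine le_trans ?_ (abs_le_of_sq_le_sq' hsq (norm_nonneg _)).2
  rw [Real.sinh_eq]
  have h1 : Real.exp |z.im| * Real.exp (-|z.im|) = 1 := by rw [← Real.exp_add]; simp
  have h2 : 2 ≤ Real.exp |z.im| := by linarith [Real.add_one_le_exp |z.im|]
  nlinarith [Real.exp_pos (-|z.im|)]

lemma isBigO_exp_sin {d : ℕ} {ℓ : Fin d → ℝ} (hℓ : ∀ i, 0 < ℓ i) {ε : ℝ} (hε : 0 < ε) (i : Fin d) :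
    (fun k : ℂ => Real.exp (|k.im| * ℓ i)) =O[cobounded ℂ ⊓ 𝓟 (admissibleContours ℓ ε)]
      fun k => Complex.sin (k * ℓ i) := by
  have hπ := Real.pi_pos
  -- On vertical sides |sin(Nℓ)| ≥ 2ε/π, halved by the bound cosh t ≥ e^{|t|}/2; on horizontal sides
  -- the constant is 1/4.
  set δ := min (ε / Real.pi) (1 / 4) with hδ
  have hδ0 : 0 < δ := by positivity
  refine IsBigO.of_bound δ⁻¹ ?_
  rw [eventually_inf_principal]
  -- On the contour ‖k‖ ≤ 2N, so this threshold yields Nℓ ≥ 1, as the horizontal sides require.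
  filter_upwards [tendsto_norm_cobounded_atTop.eventually_ge_atTop (2 / ℓ i)] with k hk hkm
  obtain ⟨N, hN, hkN⟩ := mem_iUnion₂.1 hkm
  rw [Real.norm_eq_abs, Real.abs_exp, ← div_eq_inv_mul, le_div_iff₀ hδ0, mul_comm]
  have hnorm : ‖k‖ ≤ 2 * N := by
    have := Complex.norm_le_abs_re_add_abs_im k
    linarith [hkN.1, hkN.2.1]
  have hNℓ : 1 ≤ N * ℓ i := by
    have : 2 / ℓ i ≤ 2 * N := hk.trans hnorm
    rw [div_le_iff₀ (hℓ i)] at this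
    linarith
  have him : |(k * ℓ i).im| = |k.im| * ℓ i := by simp [abs_mul, abs_of_pos (hℓ i)]
  have hre : (k * ℓ i).re = k.re * ℓ i := by simp
  rw [← him]
  rcases hkN.2.2 with h | h
  · refine le_trans ?_ (norm_sin_ge_of_abs_re (k * ℓ i))
    gcongr
    refine (min_le_left _ _).trans ?_
    have hs : |Real.sin (k * ℓ i).re| = |Real.sin (N * ℓ i)| := by
      rw [hre]
      rcases (abs_eq (by rw [← h]; positivity)).1 h with h' | h' <;> simp [h']
    rw [hs]
    have := abs_sin_ge (a := N * ℓ i) (ε := ε) (by linarith) (fun n hn => hN (by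
      refine mem_iUnion₂.2 ⟨i, n, ?_, ?_⟩
      · rw [← sub_div, div_lt_iff₀ (hℓ i)]
        exact hn.1
      · rw [← add_div, lt_div_iff₀ (hℓ i)]
        exact hn.2))
    rw [le_div_iff₀ two_pos]
    refine le_trans (le_of_eq ?_) this
    ring
  · refine le_trans ?_ (norm_sin_ge_of_abs_im (k * ℓ i) (by rw [him, h]; exact hNℓ))
    gcongr
    exact min_le_right _ _

end Asymptotics

/-! ### Comparison of the secular function with the sine product. -/

section Secular

open Filter Topology Asymptotics Bornology

variable {d : ℕ} {ℓ : Fin d → ℝ} {q : Fin d → ℝ → ℝ}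

/-- The matrix `M₁ M₂⁻¹`, the inverse of the matrix-valued Weyl function. -/
def weylInv (ℓ : Fin d → ℝ) (q : Fin d → ℝ → ℝ) (k : ℂ) :
    Matrix (Fin d × Fin 2) (Fin d × Fin 2) ℂ :=
  Matrix.of fun p r => if p.1 = r.1 then
    !![-derivWithin (sinSol (q p.1) k) (Icc 0 (ℓ p.1)) (ℓ p.1), -1;
       -1, -cosSol (q p.1) k (ℓ p.1)] p.2 r.2 /
      derivWithin (cosSol (q p.1) k) (Icc 0 (ℓ p.1)) (ℓ p.1) else 0

/-- Blockwise, the only entry that is not plain algebra is (cs' - 1)/c' = s, which is the Wronskian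
identity. -/
lemma weylInv_mul_M₂ (hℓ : ∀ i, 0 < ℓ i) (hq : ∀ i, IntervalIntegrable (q i) volume 0 (ℓ i)) {k : ℂ}
    (hk : ∀ i, derivWithin (cosSol (q i) k) (Icc 0 (ℓ i)) (ℓ i) ≠ 0) :
    weylInv ℓ q k * M₂ ℓ q k = M₁ ℓ q k := by
  ext ⟨i, a⟩ ⟨j, b⟩
  rw [Matrix.mul_apply, Fintype.sum_prod_type]
  rw [Finset.sum_eq_single i (fun m _ hm => by simp [weylInv, Ne.symm hm]) (by simp)]
  by_cases hij : i = j
  · subst hij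
    have hw := wronskian_eq_one (hℓ i) (hq i) k
    have h0 := hk i
    fin_cases a <;> fin_cases b <;> simp [weylInv, M₁, M₂] <;> field_simp
    · ring
    · linear_combination hw
  · simp [weylInv, M₁, M₂, hij]

lemma det_M₂ (ℓ : Fin d → ℝ) (q : Fin d → ℝ → ℝ) (k : ℂ) :
    (M₂ ℓ q k).det = ∏ i, derivWithin (cosSol (q i) k) (Icc 0 (ℓ i)) (ℓ i) := by
  -- `Matrix.blockDiagonal` puts the block index second, hence the swap of coordinates.
  have e : M₂ ℓ q k = (Matrix.blockDiagonal fun i => !![0, 1;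
      -derivWithin (cosSol (q i) k) (Icc 0 (ℓ i)) (ℓ i),
      -derivWithin (sinSol (q i) k) (Icc 0 (ℓ i)) (ℓ i)]).submatrix
        (Equiv.prodComm _ _) (Equiv.prodComm _ _) := by
    ext ⟨i, a⟩ ⟨j, b⟩
    simp [M₂, Matrix.blockDiagonal_apply]
  rw [e, Matrix.det_submatrix_equiv_self, Matrix.det_blockDiagonal]
  simp [Matrix.det_fin_two]

lemma secular_eq_mul (hℓ : ∀ i, 0 < ℓ i) (hq : ∀ i, IntervalIntegrable (q i) volume 0 (ℓ i))
    (U : Matrix (Fin d × Fin 2) (Fin d × Fin 2) ℂ) {k : ℂ}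
    (hk : ∀ i, derivWithin (cosSol (q i) k) (Icc 0 (ℓ i)) (ℓ i) ≠ 0) :
    secular ℓ q U k = (couplingH U * weylInv ℓ q k + 1).det *
      ∏ i, derivWithin (cosSol (q i) k) (Icc 0 (ℓ i)) (ℓ i) := by
  rw [secular, ← det_M₂, ← Matrix.det_mul, add_mul, one_mul, mul_assoc, weylInv_mul_M₂ hℓ hq hk]

lemma isLittleO_exp_mul_sin (hℓ : ∀ i, 0 < ℓ i) {ε : ℝ} (hε : 0 < ε) (i : Fin d) :
    (fun k : ℂ => Real.exp (|k.im| * ℓ i)) =o[cobounded ℂ ⊓ 𝓟 (admissibleContours ℓ ε)]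
      fun k => -k * Complex.sin (k * ℓ i) := by
  have h1 : (fun _ : ℂ => (1 : ℂ)) =o[cobounded ℂ ⊓ 𝓟 (admissibleContours ℓ ε)] fun k => -k := by
    refine IsLittleO.mono ?_ inf_le_left
    rw [isLittleO_const_left]
    right
    simpa [Function.comp_def] using tendsto_norm_cobounded_atTop (E := ℂ)
  refine (isBigO_exp_sin hℓ hε i).trans_isLittleO ?_
  simpa using h1.mul_isBigO (isBigO_refl (fun k : ℂ => Complex.sin (k * ℓ i)) _)

lemma isEquivalent_derivWithin_cosSol (hℓ : ∀ i, 0 < ℓ i)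
    (hq : ∀ i, IntervalIntegrable (q i) volume 0 (ℓ i)) {ε : ℝ} (hε : 0 < ε) (i : Fin d) :
    (fun k => derivWithin (cosSol (q i) k) (Icc 0 (ℓ i)) (ℓ i))
      ~[cobounded ℂ ⊓ 𝓟 (admissibleContours ℓ ε)] fun k => -k * Complex.sin (k * ℓ i) :=
  ((isBigO_derivWithin_cosSol_sub (hℓ i) (hq i)).mono inf_le_left).trans_isLittleO
    (isLittleO_exp_mul_sin hℓ hε i)

/-- A zero would have to bound a positive exponential from above. -/
lemma eventually_mul_sin_ne_zero (hℓ : ∀ i, 0 < ℓ i) {ε : ℝ} (hε : 0 < ε) (i : Fin d) :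
    ∀ᶠ k in cobounded ℂ ⊓ 𝓟 (admissibleContours ℓ ε), -k * Complex.sin (k * ℓ i) ≠ 0 := by
  filter_upwards [(isLittleO_exp_mul_sin hℓ hε i).bound one_pos] with k hk h0
  rw [h0, norm_zero, mul_zero, Real.norm_eq_abs, Real.abs_exp] at hk
  exact absurd (Real.exp_pos _) (not_lt.2 hk)

lemma tendsto_derivWithin_cosSol_div (hℓ : ∀ i, 0 < ℓ i)
    (hq : ∀ i, IntervalIntegrable (q i) volume 0 (ℓ i)) {ε : ℝ} (hε : 0 < ε) (i : Fin d) :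
    Tendsto (fun k => derivWithin (cosSol (q i) k) (Icc 0 (ℓ i)) (ℓ i) /
      (-k * Complex.sin (k * ℓ i))) (cobounded ℂ ⊓ 𝓟 (admissibleContours ℓ ε)) (𝓝 1) :=
  (isEquivalent_iff_tendsto_one (eventually_mul_sin_ne_zero hℓ hε i)).1
    (isEquivalent_derivWithin_cosSol hℓ hq hε i)

/-- Every numerator is O(e^{τℓ}), whereas the common denominator is equivalent to -k sin(kℓ), which
is larger by a factor of order |k|. -/
lemma tendsto_weylInv (hℓ : ∀ i, 0 < ℓ i) (hq : ∀ i, IntervalIntegrable (q i) volume 0 (ℓ i))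
    {ε : ℝ} (hε : 0 < ε) :
    Tendsto (weylInv ℓ q) (cobounded ℂ ⊓ 𝓟 (admissibleContours ℓ ε)) (𝓝 0) := by
  have key : ∀ (i : Fin d) (f : ℂ → ℂ),
      f =O[cobounded ℂ] (fun k => Real.exp (|k.im| * ℓ i)) →
      Tendsto (fun k => f k / derivWithin (cosSol (q i) k) (Icc 0 (ℓ i)) (ℓ i))
        (cobounded ℂ ⊓ 𝓟 (admissibleContours ℓ ε)) (𝓝 0) := fun i f hf =>
    (((hf.mono inf_le_left).trans_isLittleO (isLittleO_exp_mul_sin hℓ hε i)).trans_isBigO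
      (isEquivalent_derivWithin_cosSol hℓ hq hε i).symm.isBigO).tendsto_div_nhds_zero
  have hone : ∀ i, (fun _ : ℂ => (-1 : ℂ)) =O[cobounded ℂ] fun k => Real.exp (|k.im| * ℓ i) :=
    fun i => IsBigO.of_bound 1 (Eventually.of_forall fun k => by
      simpa using mul_nonneg (abs_nonneg _) (hℓ i).le)
  refine tendsto_pi_nhds.2 fun p => tendsto_pi_nhds.2 fun r => ?_
  obtain ⟨i, a⟩ := p
  obtain ⟨j, b⟩ := r
  by_cases hij : i = j
  · subst hij
    fin_cases a <;> fin_cases b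
    · simpa [weylInv] using key i _ (isBigO_derivWithin_sinSol (hℓ i) (hq i)).neg_left
    · simpa [weylInv] using key i _ (hone i)
    · simpa [weylInv] using key i _ (hone i)
    · simpa [weylInv] using key i _ (isBigO_cosSol (hℓ i) (hq i)).neg_left
  · simp only [weylInv, Matrix.of_apply, if_neg hij]
    exact tendsto_const_nhds

lemma tendsto_secular_div_sineProduct (hℓ : ∀ i, 0 < ℓ i)
    (hq : ∀ i, IntervalIntegrable (q i) volume 0 (ℓ i))
    (U : Matrix (Fin d × Fin 2) (Fin d × Fin 2) ℂ) {ε : ℝ} (hε : 0 < ε) :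
    Tendsto (fun k => secular ℓ q U k / sineProduct ℓ k)
      (cobounded ℂ ⊓ 𝓟 (admissibleContours ℓ ε)) (𝓝 1) := by
  have hdet : Tendsto (fun k => (couplingH U * weylInv ℓ q k + 1).det)
      (cobounded ℂ ⊓ 𝓟 (admissibleContours ℓ ε)) (𝓝 1) := by
    have hc : Continuous fun X : Matrix (Fin d × Fin 2) (Fin d × Fin 2) ℂ =>
        (couplingH U * X + 1).det := by fun_prop
    simpa [Function.comp_def] using (hc.tendsto 0).comp (tendsto_weylInv hℓ hq hε)
  have hprod := tendsto_finsetProd Finset.univ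
    fun i _ => tendsto_derivWithin_cosSol_div hℓ hq hε i
  have h := hdet.mul hprod
  simp only [Finset.prod_const_one, mul_one] at h
  refine h.congr' ?_
  have hne : ∀ᶠ k in cobounded ℂ ⊓ 𝓟 (admissibleContours ℓ ε),
      ∀ i, derivWithin (cosSol (q i) k) (Icc 0 (ℓ i)) (ℓ i) ≠ 0 := by
    rw [eventually_all]
    intro i
    filter_upwards [(tendsto_derivWithin_cosSol_div hℓ hq hε i).eventually_ne one_ne_zero]
      with k hk h0
    exact hk (by rw [h0, zero_div])
  filter_upwards [hne] with k hk
  rw [secular_eq_mul hℓ hq U hk, Finset.prod_div_distrib, sineProduct, mul_div_assoc]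

lemma exists_norm_secular_sub_lt (hℓ : ∀ i, 0 < ℓ i)
    (hq : ∀ i, IntervalIntegrable (q i) volume 0 (ℓ i))
    (U : Matrix (Fin d × Fin 2) (Fin d × Fin 2) ℂ) {ε : ℝ} (hε : 0 < ε) :
    ∃ K : ℝ, ∀ k ∈ admissibleContours ℓ ε, K ≤ ‖k‖ →
      ‖secular ℓ q U k - sineProduct ℓ k‖ < ‖sineProduct ℓ k‖ := by
  have h := (tendsto_secular_div_sineProduct hℓ hq U hε).eventually
    (Metric.ball_mem_nhds 1 one_pos)
  rw [eventually_inf_principal, hasBasis_cobounded_norm.eventually_iff] at h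
  obtain ⟨K, -, hK⟩ := h
  refine ⟨K, fun k hk hkK => ?_⟩
  have h1 := hK hkK hk
  rw [dist_eq_norm] at h1
  -- Were the product zero, the quotient would be 0 by convention, at distance exactly 1 from 1.
  have h0 : sineProduct ℓ k ≠ 0 := fun h0 => by simp [h0] at h1
  rwa [div_sub_one h0, norm_div, div_lt_one (norm_pos_iff.2 h0)] at h1

end Secular

end QGraph

end

/-! ### The main theorem. -/

theorem mainTheorem2 {d : ℕ} (ℓ : Fin d → ℝ) (hℓ : ∀ i, 0 < ℓ i)
    (q : Fin d → ℝ → ℝ) (hq : ∀ i, QGraph.MemW11 (ℓ i) (q i))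
    (U : Matrix (Fin d × Fin 2) (Fin d × Fin 2) ℂ)
    (hU : U ∈ Matrix.unitaryGroup (Fin d × Fin 2) ℂ)
    (hU' : (-1 : ℂ) ∉ spectrum ℂ U) :
    Differentiable ℂ (QGraph.secular ℓ q U) ∧
    ∀ ε > (0 : ℝ), ∃ K > (0 : ℝ), ∀ N > K,
      N ∉ ⋃ (i : Fin d) (n : ℕ),
        Set.Ioo (n * Real.pi / ℓ i - ε / ℓ i) (n * Real.pi / ℓ i + ε / ℓ i) →
      (QGraph.zerosIn (QGraph.secular ℓ q U) (QGraph.insideSquare N)).Finite ∧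
      (QGraph.zerosIn (QGraph.sineProduct ℓ) (QGraph.insideSquare N)).Finite ∧
      QGraph.zeroCount (QGraph.secular ℓ q U) (QGraph.insideSquare N) =
        QGraph.zeroCount (QGraph.sineProduct ℓ) (QGraph.insideSquare N) := by
  have hq' : ∀ i, IntervalIntegrable (q i) volume 0 (ℓ i) := fun i =>
    (hq i).intervalIntegrable (hℓ i).le
  have hdiff := QGraph.differentiable_secular hℓ hq' U
  refine ⟨hdiff, fun ε hε => ?_⟩
  obtain ⟨K, hK⟩ := QGraph.exists_norm_secular_sub_lt hℓ hq' U hε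
  refine ⟨max K 1, by positivity, fun N hN hNm => ?_⟩
  have hN0 : 0 < N := lt_trans (by positivity) hN
  refine QGraph.zeroCount_eq_of_norm_sub_lt hN0 hdiff
    (by unfold QGraph.sineProduct; fun_prop) fun k hk => hK k (mem_iUnion₂.2 ⟨N, hNm, hk⟩) ?_
  -- Every point of the contour has modulus at least N, so the asymptotic threshold holds on all of
  -- it.
  have hNk : N ≤ ‖k‖ := by
    rcases hk.2.2 with h | h
    · exact h ▸ Complex.abs_re_le_norm k
    · exact h ▸ Complex.abs_im_le_norm k
  exact ((le_max_left K 1).trans hN.le).trans hNk
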